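/- A Boolean algebra is not assumed to be unital: it is a set $\mathcal B$ with $\emptyset,\cap,\cup,\setminus$ such that $(\mathcal B,\cap,\cup)$ is a distributive lattice, $A\cap\emptyset=\emptyset$, $(A\cap B)\cup(A\setminus B)=A$ and $(A\cap B)\cap(A\setminus B)=\emptyset$. An ideal is a nonempty subset closed under finite unions and under passing to subsets. A relative generalized Boolean dynamical system $(\mathcal B,\mathcal L,\theta,\mathcal I_\alpha;\mathcal J)$ consists of a Boolean algebra $\mathcal B$, a set $\mathcal L$, maps $\theta_\alpha:\mathcal B\to\mathcal B$ $(\alpha\in\mathcal L)$ preserving $\emptyset,\cap,\cup,\setminus$, ideals $\mathcal I_\alpha$ of $\mathcal B$ with $\theta_\alpha(A)\in\mathcal I_\alpha$ for all $A\in\mathcal B$, and an ideal $\mathcal J$ of $\mathcal B$ consisting of regular elements. Here, with $\Delta_A=\{\alpha\in\mathcal L:\theta_\alpha(A)\neq\emptyset\}$, an element $A$ is regular if $0<|\Delta_{A'}|<\infty$ for every $\emptyset\ne A'\subseteq A$. A $(\mathcal B,\mathcal L,\theta,\mathcal I_\alpha;\mathcal J)$-representation in a $C^*$-algebra $\mathcal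 X$ is a family of projections $P_A$ $(A\in\mathcal B)$ and partial isometries $S_{\alpha,B}$ $(\alpha\in\mathcal L,\ B\in\mathcal I_\alpha)$ in $\mathcal X$ such that (i) $P_\emptyset=0$, $P_{A\cap A'}=P_AP_{A'}$, $P_{A\cup A'}=P_A+P_{A'}-P_{A\cap A'}$; (ii) $P_AS_{\alpha,B}=S_{\alpha,B}P_{\theta_\alpha(A)}$; (iii) $S_{\alpha,B}^*S_{\alpha',B'}=\delta_{\alpha,\alpha'}P_{B\cap B'}$; (iv) $P_A=\sum_{\alpha\in\Delta_A}S_{\alpha,\theta_\alpha(A)}S_{\alpha,\theta_\alpha(A)}^*$ for $A\in\mathcal J$. $C^*(\mathcal B,\mathcal L,\theta,\mathcal I_\alpha;\mathcal J)$ denotes the $C^*$-algebra generated by a universal such representation $\{p_A,s_{\alpha,B}\}$, that is, one through which every such representation in a $C^*$-algebra factors by a unique $*$-homomorphism. Let $\widehat{\mathcal B}$ be the space of ultrafilters in $\mathcal B$ with the topology generated by the sets $Z(A)=\{\xi: A\in\xi\}$, let $\chi_A=1_{Z(A)}\in C_0(\widehat{\mathcal B})$, and let $\mathcal A=\mathcal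 A(\mathcal B,\mathcal L,\theta)$ be the $C^*$-subalgebra of $C_0(\widehat{\mathcal B})$ generated by $\{\chi_A:A\in\mathcal B\}$. Let $X_\alpha=\overline{\operatorname{span}}\{\chi_A:A\in\mathcal I_\alpha\}$, and let $X=X(\mathcal B,\mathcal L,\theta,\mathcal I_\alpha)$ be the right Hilbert $\mathcal A$-module of all $(x_\alpha)\in\prod_\alpha X_\alpha$ for which $\sum_\alpha x_\alpha^*x_\alpha$ converges in $\mathcal A$, with $\langle x,y\rangle=\sum_\alpha x_\alpha^*y_\alpha$ and $x\cdot f=(x_\alpha f)_\alpha$. It is a $C^*$-correspondence over $\mathcal A$ with left action $\phi(f)(x_\alpha)_\alpha=(\phi_\alpha(f)x_\alpha)_\alpha$, where $\phi_\alpha:\mathcal A\to X_\alpha$ is the $*$-homomorphism with $\phi_\alpha(\chi_A)=\chi_{\theta_\alpha(A)}$. For $B\in\mathcal I_\alpha$ let $e_{\alpha,B}=(\delta_{\alpha,\beta}\chi_B)_{\beta\in\mathcal L}\in X$. Let $\mathfrak K(X)$ be the closed span of the operators $\Theta_{x,y}:z\mapsto x\langle y,z\rangle$. A representation of $X$ on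 a $C^*$-algebra $\mathcal X$ is a pair $(\pi,t)$ of a $*$-homomorphism $\pi:\mathcal A\to\mathcal X$ and a linear map $t:X\to\mathcal X$ with $t(x)^*t(y)=\pi(\langle x,y\rangle)$ and $\pi(f)t(x)=t(\phi(f)x)$. For an ideal $K\subseteq\phi^{-1}(\mathfrak K(X))$, it is $K$-coisometric if $\pi(f)=\psi_t(\phi(f))$ for all $f\in K$, where $\psi_t:\mathfrak K(X)\to\mathcal X$ is the $*$-homomorphism with $\psi_t(\Theta_{x,y})=t(x)t(y)^*$. The relative Cuntz–Pimsner algebra $\mathcal O_{(K,X)}$ is the $C^*$-algebra generated by a universal $K$-coisometric representation of $X$. Put $K_{\mathcal J}=\overline{\operatorname{span}}\{\chi_A:A\in\mathcal J\}$. **Theorem.** Let $(\mathcal B,\mathcal L,\theta,\mathcal I_\alpha;\mathcal J)$ be a relative generalized Boolean dynamical system. For every $C^*$-algebra $\mathcal X$, the map $$(\pi,t)\longmapsto\{\pi(\chi_A),\,t(e_{\alpha,B}):A\in\mathcal B,\ \alpha\in\mathcal L,\ B\in\mathcal I_\alpha\}$$ is a bijection from the set of $K_{\mathcal J}$-coisometric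 representations of $X$ on $\mathcal X$ onto the set of $(\mathcal B,\mathcal L,\theta,\mathcal I_\alpha;\mathcal J)$-representations in $\mathcal X$. Consequently, the universal $(\mathcal B,\mathcal L,\theta,\mathcal I_\alpha;\mathcal J)$-representation $\{p_A,s_{\alpha,B}\}$ and the universal $K_{\mathcal J}$-coisometric representation $(\pi,t)$ exist, and there is a $*$-isomorphism $$C^*(\mathcal B,\mathcal L,\theta,\mathcal I_\alpha;\mathcal J)\;\cong\;\mathcal O_{(K_{\mathcal J},X)}$$ which maps $p_A$ to $\pi(\chi_A)$ and $s_{\alpha,B}$ to $t(e_{\alpha,B})$. -/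

import Mathlib

universe u v w

open scoped ZeroAtInfty InnerProductSpace
open Filter Topology

set_option linter.unusedSectionVars false

noncomputable section

namespace RelBoolSys

/-! ### Boolean algebras and Boolean dynamical systems

A (not necessarily unital) Boolean algebra is a `GeneralizedBooleanAlgebra`, with
`A ⊓ B`, `A ⊔ B`, `A \ B`, `⊥` for intersection, union, relative complement and the empty set.
An ideal of a Boolean algebra is an `Order.Ideal`: a nonempty lower set closed under unions. -/

/-- An action on a Boolean algebra: a Boolean homomorphism `B → B` preserving `∅`. -/
structure BooleanAction (B : Type u) [GeneralizedBooleanAlgebra B] where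
  toFun : B → B
  map_inf : ∀ A A' : B, toFun (A ⊓ A') = toFun A ⊓ toFun A'
  map_sup : ∀ A A' : B, toFun (A ⊔ A') = toFun A ⊔ toFun A'
  map_sdiff : ∀ A A' : B, toFun (A \ A') = toFun A \ toFun A'
  map_bot : toFun ⊥ = ⊥

/-- A Boolean dynamical system `(B, L, θ)`. -/
structure BooleanDynamicalSystem (B : Type u) (L : Type v) [GeneralizedBooleanAlgebra B] where
  action : L → BooleanAction B

namespace BooleanDynamicalSystem

variable {B : Type u} {L : Type v} [GeneralizedBooleanAlgebra B]

/-- The map `θ_α : B → B`. -/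
def θ (S : BooleanDynamicalSystem B L) (α : L) (A : B) : B := (S.action α).toFun A

/-- `Δ_A = {α : θ_α(A) ≠ ∅}`. -/
def Δ (S : BooleanDynamicalSystem B L) (A : B) : Set L := {α | S.θ α A ≠ ⊥}

/-- `A` is regular if `0 < |Δ_A'| < ∞` for every nonempty `A' ⊆ A`. -/
def IsRegular (S : BooleanDynamicalSystem B L) (A : B) : Prop :=
  ∀ A' : B, A' ≤ A → A' ≠ ⊥ → (S.Δ A').Nonempty ∧ (S.Δ A').Finite

/-- `R_α = {A : A ⊆ θ_α(A') for some A'}`. -/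
def R (S : BooleanDynamicalSystem B L) (α : L) : Set B := {A | ∃ A' : B, A ≤ S.θ α A'}

end BooleanDynamicalSystem

/-- A generalized Boolean dynamical system `(B, L, θ, I_α)`. -/
structure GeneralizedBooleanDynamicalSystem (B : Type u) (L : Type v)
    [GeneralizedBooleanAlgebra B] extends BooleanDynamicalSystem B L where
  I : L → Order.Ideal B
  R_subset_I : ∀ α : L, toBooleanDynamicalSystem.R α ⊆ (I α : Set B)

/-- A relative generalized Boolean dynamical system `(B, L, θ, I_α; J)`: here `J` is an ideal
of `B` all of whose elements are regular. -/
structure RelativeBooleanDynamicalSystem (B : Type u) (L : Type v)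
    [GeneralizedBooleanAlgebra B] extends GeneralizedBooleanDynamicalSystem B L where
  J : Order.Ideal B
  isRegular_of_mem_J : ∀ A ∈ J, toBooleanDynamicalSystem.IsRegular A

/-- `θ_α(A)` as an element of `I_α`. -/
def GeneralizedBooleanDynamicalSystem.θI {B : Type u} {L : Type v} [GeneralizedBooleanAlgebra B]
    (S : GeneralizedBooleanDynamicalSystem B L) (α : L) (A : B) : S.I α :=
  ⟨S.θ α A, S.R_subset_I α ⟨A, le_rfl⟩⟩

/-! ### The Stone dual of a Boolean algebra -/

/-- A point of the Stone dual of `B`: an ultrafilter in `B`, i.e. a proper prime filter. -/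
@[ext]
structure StoneDual (B : Type u) [GeneralizedBooleanAlgebra B] where
  carrier : Set B
  nonempty : carrier.Nonempty
  bot_notMem : ⊥ ∉ carrier
  mem_of_le : ∀ {A A' : B}, A ∈ carrier → A ≤ A' → A' ∈ carrier
  inf_mem : ∀ {A A' : B}, A ∈ carrier → A' ∈ carrier → A ⊓ A' ∈ carrier
  mem_or_mem : ∀ {A A' : B}, A ⊔ A' ∈ carrier → A ∈ carrier ∨ A' ∈ carrier

section StoneDual

variable {B : Type u} [GeneralizedBooleanAlgebra B]

/-- `Z(A)`: the set of ultrafilters containing `A`. -/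
def Z (A : B) : Set (StoneDual B) := {ξ | A ∈ ξ.carrier}

/-- The topology of the Stone dual, generated by the sets `Z(A)`. -/
instance : TopologicalSpace (StoneDual B) :=
  TopologicalSpace.generateFrom (Set.range (Z (B := B)))

lemma isOpen_Z (A : B) : IsOpen (Z A) := TopologicalSpace.isOpen_generateFrom_of_mem ⟨A, rfl⟩

lemma Z_inf (A A' : B) : Z (A ⊓ A') = Z A ∩ Z A' := by
  ext ξ
  exact ⟨fun h => ⟨ξ.mem_of_le h inf_le_left, ξ.mem_of_le h inf_le_right⟩,
    fun h => ξ.inf_mem h.1 h.2⟩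

lemma Z_sup (A A' : B) : Z (A ⊔ A') = Z A ∪ Z A' := by
  ext ξ
  exact ⟨fun h => ξ.mem_or_mem h, fun h => h.elim (fun h => ξ.mem_of_le h le_sup_left)
    (fun h => ξ.mem_of_le h le_sup_right)⟩

lemma Z_bot : Z (⊥ : B) = ∅ := by
  ext ξ
  simpa [Z] using ξ.bot_notMem

lemma Z_mono {A A' : B} (h : A ≤ A') : Z A ⊆ Z A' := fun ξ hξ => ξ.mem_of_le hξ h

lemma isClosed_Z (A : B) : IsClosed (Z A) := by
  rw [← isOpen_compl_iff]
  have : (Z A)ᶜ = ⋃ C : B, Z (C \ A) := by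
    ext ξ
    simp only [Set.mem_compl_iff, Set.mem_iUnion]
    constructor
    · intro h
      obtain ⟨C, hC⟩ := ξ.nonempty
      refine ⟨C, ?_⟩
      have h1 : C ⊓ A ⊔ C \ A ∈ ξ.carrier := by rwa [sup_inf_sdiff]
      rcases ξ.mem_or_mem h1 with h2 | h2
      · exact absurd (ξ.mem_of_le h2 inf_le_right) h
      · exact h2
    · rintro ⟨C, hC⟩ hA
      have := ξ.inf_mem hA hC
      rw [inf_sdiff_self_right] at this
      exact ξ.bot_notMem this
  rw [this]
  exact isOpen_iUnion fun C => isOpen_Z _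

lemma isCompact_Z (A : B) : IsCompact (Z A) := by
  rw [isCompact_iff_ultrafilter_le_nhds]
  intro F hF
  rw [le_principal_iff] at hF
  let ξ : StoneDual B :=
    { carrier := {C | Z C ∈ F}
      nonempty := ⟨A, hF⟩
      bot_notMem := by simp [Z_bot]
      mem_of_le := fun h h' => mem_of_superset h (Z_mono h')
      inf_mem := fun h h' => by
        have := inter_mem h h'
        rwa [← Z_inf] at this
      mem_or_mem := fun h => by
        rw [Set.mem_ofPred_eq, Z_sup] at h
        exact Ultrafilter.union_mem_iff.1 h }
  refine ⟨ξ, hF, ?_⟩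
  rw [TopologicalSpace.nhds_generateFrom]
  refine le_iInf₂ fun s hs => ?_
  obtain ⟨hξ, C, rfl⟩ := hs
  exact le_principal_iff.2 hξ

/-- Every compact set of ultrafilters is contained in some `Z(A)`. -/
lemma exists_subset_Z {K : Set (StoneDual B)} (hK : IsCompact K) : ∃ A : B, K ⊆ Z A := by
  refine hK.induction_on ⟨⊥, by simp⟩ (fun s t h ⟨A, hA⟩ => ⟨A, h.trans hA⟩)
    (fun s t ⟨A, hA⟩ ⟨A', hA'⟩ => ⟨A ⊔ A', ?_⟩) (fun ξ _ => ?_)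
  · rw [Z_sup]
    exact Set.union_subset_union hA hA'
  · obtain ⟨A, hA⟩ := ξ.nonempty
    exact ⟨Z A, mem_nhdsWithin_of_mem_nhds ((isOpen_Z A).mem_nhds hA), A, subset_rfl⟩

/-- `χ_A`, the indicator function of `Z(A)`, as an element of `C₀` of the Stone dual. -/
def chi₀ (A : B) : C₀(StoneDual B, ℂ) where
  toFun := (Z A).indicator 1
  continuous_toFun := (IsClopen.continuous_indicator ⟨isClosed_Z A, isOpen_Z A⟩ continuous_one)
  zero_at_infty' := by
    refine tendsto_const_nhds.congr' ?_
    filter_upwards [(isCompact_Z A).compl_mem_cocompact] with ξ hξ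
    exact (Set.indicator_of_notMem hξ _).symm

lemma chi₀_apply (A : B) (ξ : StoneDual B) : chi₀ A ξ = (Z A).indicator 1 ξ := rfl

lemma chi₀_mul (A A' : B) : chi₀ A * chi₀ A' = chi₀ (A ⊓ A') := by
  ext ξ
  simp only [ZeroAtInftyContinuousMap.mul_apply, chi₀_apply, Z_inf, Set.inter_indicator_one,
    Pi.mul_apply]

lemma star_chi₀ (A : B) : star (chi₀ A) = chi₀ A := by
  ext ξ
  by_cases h : ξ ∈ Z A <;> simp [chi₀_apply, h]

/-! ### The transpose of an action -/

/-- The preimage of an ultrafilter under an action is an ultrafilter, if it is nonempty. -/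
def BooleanAction.pull (h : BooleanAction B) (ξ : StoneDual B)
    (hξ : ∃ A, h.toFun A ∈ ξ.carrier) : StoneDual B where
  carrier := {A | h.toFun A ∈ ξ.carrier}
  nonempty := hξ
  bot_notMem := by
    simpa [h.map_bot] using ξ.bot_notMem
  mem_of_le := fun {A A'} hA hle => by
    refine ξ.mem_of_le hA ?_
    rw [← inf_eq_left, ← h.map_inf, inf_eq_left.2 hle]
  inf_mem := fun hA hA' => by
    rw [Set.mem_ofPred_eq, h.map_inf]
    exact ξ.inf_mem hA hA'
  mem_or_mem := fun hA => by
    rw [Set.mem_ofPred_eq, h.map_sup] at hA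
    exact ξ.mem_or_mem hA

open Classical in
/-- The function `ξ ↦ f(θ⁻¹(ξ))`, extended by `0` where `θ⁻¹(ξ)` is empty. -/
def BooleanAction.pullFun (h : BooleanAction B) (f : StoneDual B → ℂ) (ξ : StoneDual B) : ℂ :=
  if hξ : ∃ A, h.toFun A ∈ ξ.carrier then f (h.pull ξ hξ) else 0

lemma BooleanAction.norm_pullFun_lt (h : BooleanAction B) (f : C₀(StoneDual B, ℂ)) {ε : ℝ}
    (hε : 0 < ε) : ∃ A : B, ∀ ξ, ξ ∉ Z (h.toFun A) → ‖h.pullFun f ξ‖ < ε := by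
  have h1 : ∀ᶠ ξ in cocompact (StoneDual B), ‖f ξ‖ < ε := by
    have := f.zero_at_infty'.norm
    rw [norm_zero] at this
    exact this.eventually_lt_const hε
  obtain ⟨K, hK, hKf⟩ := mem_cocompact.1 h1
  obtain ⟨A, hA⟩ := exists_subset_Z hK
  refine ⟨A, fun ξ hξ => ?_⟩
  unfold BooleanAction.pullFun
  split_ifs with hex
  · exact hKf fun hmem => hξ (hA hmem)
  · simpa using hε

lemma BooleanAction.continuous_pullFun (h : BooleanAction B) (f : C₀(StoneDual B, ℂ)) :
    Continuous (h.pullFun f) := by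
  rw [continuous_iff_continuousAt]
  intro ξ
  classical
  by_cases hξ : ∃ A, h.toFun A ∈ ξ.carrier
  · have hpull : Tendsto (fun η => if hη : ∃ A, h.toFun A ∈ η.carrier then h.pull η hη
        else h.pull ξ hξ) (𝓝 ξ) (𝓝 (h.pull ξ hξ)) := by
      rw [TopologicalSpace.tendsto_nhds_generateFrom_iff]
      rintro _ ⟨C, rfl⟩ hC
      filter_upwards [(isOpen_Z (h.toFun C)).mem_nhds hC] with η hη
      have hex : ∃ A, h.toFun A ∈ η.carrier := ⟨C, hη⟩
      simp only [Set.mem_preimage, dif_pos hex]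
      exact hη
    have hf := (f.continuous_toFun.tendsto (h.pull ξ hξ)).comp hpull
    have hval : h.pullFun f ξ = f (h.pull ξ hξ) := dif_pos hξ
    unfold ContinuousAt
    rw [hval]
    refine hf.congr' ?_
    obtain ⟨A, hA⟩ := hξ
    filter_upwards [(isOpen_Z (h.toFun A)).mem_nhds hA] with η hη
    have hex : ∃ A, h.toFun A ∈ η.carrier := ⟨A, hη⟩
    simp only [Function.comp, dif_pos hex, BooleanAction.pullFun]
    rfl
  · have hval : h.pullFun f ξ = 0 := dif_neg hξ
    unfold ContinuousAt
    rw [hval, tendsto_zero_iff_norm_tendsto_zero]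
    refine (Metric.tendsto_nhds.2 fun ε hε => ?_)
    obtain ⟨A, hA⟩ := h.norm_pullFun_lt f hε
    filter_upwards [(isClosed_Z (h.toFun A)).isOpen_compl.mem_nhds (fun hm => hξ ⟨A, hm⟩)]
      with η hη
    simpa using hA η hη

/-- The `*`-homomorphism of `C₀` of the Stone dual induced by an action. -/
def BooleanAction.pullHom (h : BooleanAction B) :
    C₀(StoneDual B, ℂ) →⋆ₙₐ[ℂ] C₀(StoneDual B, ℂ) where
  toFun f :=
    { toFun := h.pullFun f
      continuous_toFun := h.continuous_pullFun f
      zero_at_infty' := by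
        rw [tendsto_zero_iff_norm_tendsto_zero]
        refine (Metric.tendsto_nhds.2 fun ε hε => ?_)
        obtain ⟨A, hA⟩ := h.norm_pullFun_lt f hε
        filter_upwards [(isCompact_Z (h.toFun A)).compl_mem_cocompact] with η hη
        simpa using hA η hη }
  map_smul' c f := by
    ext ξ
    by_cases hξ : ∃ A, h.toFun A ∈ ξ.carrier <;> simp [BooleanAction.pullFun, hξ]
  map_zero' := by
    ext ξ
    simp [BooleanAction.pullFun]
  map_add' f g := by
    ext ξ
    by_cases hξ : ∃ A, h.toFun A ∈ ξ.carrier <;> simp [BooleanAction.pullFun, hξ]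
  map_mul' f g := by
    ext ξ
    by_cases hξ : ∃ A, h.toFun A ∈ ξ.carrier <;> simp [BooleanAction.pullFun, hξ]
  map_star' f := by
    ext ξ
    by_cases hξ : ∃ A, h.toFun A ∈ ξ.carrier <;> simp [BooleanAction.pullFun, hξ]

lemma BooleanAction.pullHom_chi₀ (h : BooleanAction B) (A : B) :
    h.pullHom (chi₀ A) = chi₀ (h.toFun A) := by
  ext ξ
  change h.pullFun (chi₀ A) ξ = _
  by_cases hA : h.toFun A ∈ ξ.carrier
  · have hξ : ∃ A, h.toFun A ∈ ξ.carrier := ⟨A, hA⟩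
    have h1 : h.pull ξ hξ ∈ Z A := hA
    have h2 : ξ ∈ Z (h.toFun A) := hA
    simp [BooleanAction.pullFun, dif_pos hξ, chi₀_apply, h1, h2]
  · have h2 : ξ ∉ Z (h.toFun A) := hA
    rw [chi₀_apply, Set.indicator_of_notMem h2]
    by_cases hξ : ∃ A, h.toFun A ∈ ξ.carrier
    · have h1 : h.pull ξ hξ ∉ Z A := hA
      simp [BooleanAction.pullFun, dif_pos hξ, chi₀_apply, h1]
    · exact dif_neg hξ

end StoneDual

/-! ### Adjointable and compact operators on a Hilbert module -/

section HilbertModule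

variable (A : Type u) (E : Type v) [NonUnitalCStarAlgebra A] [PartialOrder A] [StarOrderedRing A]
  [NormedAddCommGroup E] [NormedSpace ℂ E] [SMul A E] [CStarModule A E]

/-- An adjointable operator `T` on the Hilbert `A`-module `E`, together with its adjoint
(which is determined by `T`, see `Adjointable.ext`). -/
structure Adjointable where
  toCLM : E →L[ℂ] E
  adj : E →L[ℂ] E
  inner_apply : ∀ x y : E, ⟪x, toCLM y⟫_A = ⟪adj x, y⟫_A

variable {A E}

variable (A) in
lemma ext_inner {x y : E} (h : ∀ w : E, ⟪w, x⟫_A = ⟪w, y⟫_A) : x = y := by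
  rw [← sub_eq_zero, ← CStarModule.inner_self (A := A), CStarModule.inner_sub_right, h, sub_self]

namespace Adjointable

lemma inner_apply' (T : Adjointable A E) (x y : E) : ⟪T.toCLM x, y⟫_A = ⟪x, T.adj y⟫_A := by
  rw [← CStarModule.star_inner, T.inner_apply, CStarModule.star_inner]

lemma toCLM_injective : Function.Injective (toCLM : Adjointable A E → E →L[ℂ] E) := by
  rintro ⟨T, S, h⟩ ⟨T', S', h'⟩ (rfl : T = T')
  congr
  ext x
  refine ext_inner A fun w => ?_
  rw [← CStarModule.star_inner, ← h, h', CStarModule.star_inner]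

@[ext]
lemma ext {T T' : Adjointable A E} (h : ∀ x, T.toCLM x = T'.toCLM x) : T = T' :=
  toCLM_injective (ContinuousLinearMap.ext h)

instance : Zero (Adjointable A E) := ⟨⟨0, 0, by simp⟩⟩

instance : Add (Adjointable A E) :=
  ⟨fun T S => ⟨T.toCLM + S.toCLM, T.adj + S.adj, by simp [T.inner_apply, S.inner_apply]⟩⟩

instance : Neg (Adjointable A E) :=
  ⟨fun T => ⟨-T.toCLM, -T.adj, by simp [T.inner_apply]⟩⟩

instance : Sub (Adjointable A E) :=
  ⟨fun T S => ⟨T.toCLM - S.toCLM, T.adj - S.adj, by simp [T.inner_apply, S.inner_apply]⟩⟩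

/-- The product is composition. -/
instance : Mul (Adjointable A E) :=
  ⟨fun T S => ⟨T.toCLM ∘L S.toCLM, S.adj ∘L T.adj, by simp [T.inner_apply, S.inner_apply]⟩⟩

/-- The involution is the adjoint. -/
instance : Star (Adjointable A E) :=
  ⟨fun T => ⟨T.adj, T.toCLM, fun x y => (T.inner_apply' x y).symm⟩⟩

instance : SMul ℂ (Adjointable A E) :=
  ⟨fun c T => ⟨c • T.toCLM, star c • T.adj, by simp [T.inner_apply]⟩⟩

instance : SMul ℕ (Adjointable A E) :=
  ⟨fun n T => ⟨n • T.toCLM, n • T.adj, by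
    simp [T.inner_apply, ← Nat.cast_smul_eq_nsmul ℂ]⟩⟩

instance : SMul ℤ (Adjointable A E) :=
  ⟨fun n T => ⟨n • T.toCLM, n • T.adj, by
    simp [T.inner_apply, ← Int.cast_smul_eq_zsmul ℂ]⟩⟩

instance : NonUnitalRing (Adjointable A E) :=
  toCLM_injective.nonUnitalRing toCLM rfl (fun _ _ => rfl) (fun _ _ => rfl) (fun _ => rfl)
    (fun _ _ => rfl) (fun _ _ => rfl) (fun _ _ => rfl)

/-- The inclusion of the adjointable operators into the bounded operators. -/
def toCLMHom : Adjointable A E →ₙ+* (E →L[ℂ] E) where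
  toFun := toCLM
  map_mul' _ _ := rfl
  map_zero' := rfl
  map_add' _ _ := rfl

/-- The norm is the operator norm. -/
instance : NonUnitalNormedRing (Adjointable A E) :=
  NonUnitalNormedRing.induced (Adjointable A E) (E →L[ℂ] E) toCLMHom toCLM_injective

lemma norm_def (T : Adjointable A E) : ‖T‖ = ‖T.toCLM‖ := rfl

instance : Module ℂ (Adjointable A E) :=
  toCLM_injective.module ℂ (toCLMHom : Adjointable A E →ₙ+* (E →L[ℂ] E)).toAddMonoidHom
    (fun _ _ => rfl)

instance : NormedSpace ℂ (Adjointable A E) where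
  norm_smul_le c T := norm_smul_le c T.toCLM

instance : IsScalarTower ℂ (Adjointable A E) (Adjointable A E) :=
  ⟨fun _ _ _ => toCLM_injective rfl⟩

instance : SMulCommClass ℂ (Adjointable A E) (Adjointable A E) :=
  ⟨fun c T S => by ext x; exact (T.toCLM.map_smul c (S.toCLM x)).symm⟩

instance : StarRing (Adjointable A E) where
  star_involutive _ := rfl
  star_mul _ _ := rfl
  star_add _ _ := rfl

instance : StarModule ℂ (Adjointable A E) := ⟨fun _ _ => toCLM_injective rfl⟩

instance : CStarRing (Adjointable A E) where
  norm_mul_self_le T := by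
    have h : ∀ x, ‖T.toCLM x‖ ≤ √‖star T * T‖ * ‖x‖ := fun x => by
      refine abs_le_of_sq_le_sq' ?_ (by positivity) |>.2
      rw [mul_pow, Real.sq_sqrt (norm_nonneg _), CStarModule.norm_sq_eq A, T.inner_apply' x]
      calc ‖⟪x, T.adj (T.toCLM x)⟫_A‖ ≤ ‖x‖ * ‖(star T * T).toCLM x‖ :=
            CStarModule.norm_inner_le E
        _ ≤ ‖x‖ * (‖star T * T‖ * ‖x‖) := by
            gcongr
            exact (star T * T).toCLM.le_opNorm x
        _ = ‖star T * T‖ * ‖x‖ ^ 2 := by ring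
    have h2 : ‖T‖ ≤ √‖star T * T‖ := T.toCLM.opNorm_le_bound (Real.sqrt_nonneg _) h
    calc ‖T‖ * ‖T‖ ≤ √‖star T * T‖ * √‖star T * T‖ := by gcongr
      _ = ‖star T * T‖ := Real.mul_self_sqrt (norm_nonneg _)

end Adjointable

lemma add_smul_left (a b : A) (x : E) : (a + b) • x = a • x + b • x :=
  ext_inner A fun w => by simp [add_mul]

lemma complex_smul_left (c : ℂ) (a : A) (x : E) : (c • a) • x = c • (a • x) :=
  ext_inner A fun w => by simp [smul_mul_assoc]

lemma norm_smul_left_le (a : A) (x : E) : ‖a • x‖ ≤ ‖a‖ * ‖x‖ := by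
  refine abs_le_of_sq_le_sq' ?_ (by positivity) |>.2
  rw [mul_pow, CStarModule.norm_sq_eq A (x := a • x), CStarModule.norm_sq_eq A (x := x),
    CStarModule.inner_op_smul_right, CStarModule.inner_op_smul_left]
  calc ‖a * (⟪x, x⟫_A * star a)‖ ≤ ‖a‖ * (‖⟪x, x⟫_A‖ * ‖star a‖) :=
        (norm_mul_le _ _).trans (by gcongr; exact norm_mul_le _ _)
    _ = ‖a‖ ^ 2 * ‖⟪x, x⟫_A‖ := by rw [norm_star]; ring

/-- The bounded operator `z ↦ x ⟨y, z⟩`. -/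
def thetaCLM (A : Type u) {E : Type v} [NonUnitalCStarAlgebra A] [PartialOrder A]
    [StarOrderedRing A] [NormedAddCommGroup E] [NormedSpace ℂ E] [SMul A E] [CStarModule A E]
    (x y : E) : E →L[ℂ] E :=
  LinearMap.mkContinuous
    { toFun := fun z => ⟪y, z⟫_A • x
      map_add' := fun z z' => by rw [CStarModule.inner_add_right, add_smul_left]
      map_smul' := fun c z => by
        rw [CStarModule.inner_smul_right_complex, complex_smul_left, RingHom.id_apply] }
    (‖y‖ * ‖x‖)
    (fun z => by
      calc ‖⟪y, z⟫_A • x‖ ≤ ‖⟪y, z⟫_A‖ * ‖x‖ := norm_smul_left_le _ _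
        _ ≤ (‖y‖ * ‖z‖) * ‖x‖ := by gcongr; exact CStarModule.norm_inner_le E
        _ = ‖y‖ * ‖x‖ * ‖z‖ := by ring)

/-- The rank one operator `Θ_{x,y} : z ↦ x ⟨y, z⟩`, with adjoint `Θ_{y,x}`. -/
def Theta (A : Type u) {E : Type v} [NonUnitalCStarAlgebra A] [PartialOrder A]
    [StarOrderedRing A] [NormedAddCommGroup E] [NormedSpace ℂ E] [SMul A E] [CStarModule A E]
    (x y : E) : Adjointable A E where
  toCLM := thetaCLM A x y
  adj := thetaCLM A y x
  inner_apply w z := by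
    change ⟪w, ⟪y, z⟫_A • x⟫_A = ⟪⟪x, w⟫_A • y, z⟫_A
    rw [CStarModule.inner_op_smul_right, CStarModule.inner_op_smul_left, CStarModule.star_inner]

lemma Theta_apply (x y z : E) : (Theta A x y).toCLM z = ⟪y, z⟫_A • x := rfl

lemma Theta_mul (x y : E) (T : Adjointable A E) : Theta A x y * T = Theta A x (T.adj y) := by
  ext z
  change ⟪y, T.toCLM z⟫_A • x = ⟪T.adj y, z⟫_A • x
  rw [T.inner_apply]

lemma star_Theta (x y : E) : star (Theta A x y) = Theta A y x := rfl

/-- The linear span of the rank one operators. -/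
def finiteRank (A : Type u) (E : Type v) [NonUnitalCStarAlgebra A] [PartialOrder A]
    [StarOrderedRing A] [NormedAddCommGroup E] [NormedSpace ℂ E] [SMul A E] [CStarModule A E] :
    NonUnitalStarSubalgebra ℂ (Adjointable A E) where
  carrier := Submodule.span ℂ {T | ∃ x y : E, T = Theta A x y}
  zero_mem' := Submodule.zero_mem _
  add_mem' := Submodule.add_mem _
  smul_mem' c _ := Submodule.smul_mem _ c
  mul_mem' {T S} hT _ := by
    induction hT using Submodule.span_induction with
    | mem T h =>
      obtain ⟨x, y, rfl⟩ := h
      exact Submodule.subset_span ⟨x, S.adj y, Theta_mul x y S⟩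
    | zero => rw [zero_mul]; exact Submodule.zero_mem _
    | add T T' _ _ h h' => rw [add_mul]; exact Submodule.add_mem _ h h'
    | smul c T _ h => rw [smul_mul_assoc]; exact Submodule.smul_mem _ c h
  star_mem' {T} hT := by
    induction hT using Submodule.span_induction with
    | mem T h =>
      obtain ⟨x, y, rfl⟩ := h
      exact Submodule.subset_span ⟨y, x, rfl⟩
    | zero => rw [star_zero]; exact Submodule.zero_mem _
    | add T T' _ _ h h' => rw [star_add]; exact Submodule.add_mem _ h h'
    | smul c T _ h => rw [star_smul]; exact Submodule.smul_mem _ _ h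

/-- The (generalized) compact operators: the norm closure of the span of the `Θ_{x,y}`. -/
def compacts (A : Type u) (E : Type v) [NonUnitalCStarAlgebra A] [PartialOrder A]
    [StarOrderedRing A] [NormedAddCommGroup E] [NormedSpace ℂ E] [SMul A E] [CStarModule A E] :
    NonUnitalStarSubalgebra ℂ (Adjointable A E) :=
  (finiteRank A E).topologicalClosure

lemma Theta_mem_compacts (x y : E) : Theta A x y ∈ compacts A E :=
  (finiteRank A E).le_topologicalClosure (Submodule.subset_span ⟨x, y, rfl⟩)

end HilbertModule

/-! ### Representations of `C*`-correspondences

A `C*`-correspondence over `A` is a Hilbert `A`-module `E` with a `*`-homomorphism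
`φ : A → Adjointable A E`. Only commutative `A` occur here, so that Mathlib's `CStarModule`, which
writes the module action as `a • x`, is the usual notion of a right Hilbert module, with
`x · a = a • x`. -/

section Correspondence

variable {A : Type u} {E : Type v} [NonUnitalCommCStarAlgebra A] [PartialOrder A]
  [StarOrderedRing A] [NormedAddCommGroup E] [NormedSpace ℂ E] [SMul A E] [CStarModule A E]

/-- A (Toeplitz) representation `(π, t)` of the `C*`-correspondence `(E, φ)` on `𝒳`. -/
@[ext]
structure ToeplitzRep (φ : A →⋆ₙₐ[ℂ] Adjointable A E) (𝒳 : Type w) [NonUnitalCStarAlgebra 𝒳] where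
  π : A →⋆ₙₐ[ℂ] 𝒳
  t : E →ₗ[ℂ] 𝒳
  star_t_mul_t : ∀ x y : E, star (t x) * t y = π ⟪x, y⟫_A
  π_mul_t : ∀ (f : A) (x : E), π f * t x = t ((φ f).toCLM x)

/-- `(π, t)` is `K`-coisometric: `K ⊆ φ⁻¹(compacts)` and `π(f) = ψ_t(φ(f))` for `f ∈ K`, where
`ψ_t` is the (unique) `*`-homomorphism on the compacts with `ψ_t(Θ_{x,y}) = t(x) t(y)*`. -/
def ToeplitzRep.IsCoisometric {φ : A →⋆ₙₐ[ℂ] Adjointable A E} {𝒳 : Type w}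
    [NonUnitalCStarAlgebra 𝒳] (ρ : ToeplitzRep φ 𝒳) (K : Set A) : Prop :=
  ∃ ψ : compacts A E →⋆ₙₐ[ℂ] 𝒳,
    (∀ x y : E, ψ ⟨Theta A x y, Theta_mem_compacts x y⟩ = ρ.t x * star (ρ.t y)) ∧
    ∀ f ∈ K, ∃ hf : φ f ∈ compacts A E, ρ.π f = ψ ⟨φ f, hf⟩

/-- `ρ = (π, t)` exhibits `𝒪` as the relative Cuntz–Pimsner algebra `𝒪_(K, E)`: it is a universal
`K`-coisometric representation, and `𝒪` is generated by its range. -/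
structure ToeplitzRep.IsRelativeCuntzPimsner {φ : A →⋆ₙₐ[ℂ] Adjointable A E} {𝒪 : Type w}
    [NonUnitalCStarAlgebra 𝒪] (ρ : ToeplitzRep φ 𝒪) (K : Set A) : Prop where
  isCoisometric : ρ.IsCoisometric K
  generates :
    (NonUnitalStarAlgebra.adjoin ℂ (Set.range ρ.π ∪ Set.range ρ.t)).topologicalClosure = ⊤
  universal : ∀ (𝒳 : Type w) [NonUnitalCStarAlgebra 𝒳] (σ : ToeplitzRep φ 𝒳),
    σ.IsCoisometric K →
      ∃! Φ : 𝒪 →⋆ₙₐ[ℂ] 𝒳, (∀ f, Φ (ρ.π f) = σ.π f) ∧ ∀ x, Φ (ρ.t x) = σ.t x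

end Correspondence

/-! ### The coefficient algebra `𝒜(B, L, θ)` -/

section CoeffAlgebra

variable (B : Type u) [GeneralizedBooleanAlgebra B]

/-- The `C*`-subalgebra of `C₀` of the Stone dual generated by the functions `χ_A`. -/
def coeffSubalgebra : NonUnitalStarSubalgebra ℂ C₀(StoneDual B, ℂ) :=
  (NonUnitalStarAlgebra.adjoin ℂ (Set.range (chi₀ (B := B)))).topologicalClosure

/-- The `C*`-algebra `𝒜(B, L, θ)`, which depends on `B` only. -/
def CoeffAlgebra : Type u := coeffSubalgebra B

instance : NonUnitalCommCStarAlgebra (CoeffAlgebra B) :=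
  NonUnitalStarSubalgebra.nonUnitalCommCStarAlgebra (coeffSubalgebra B)
    (h_closed := NonUnitalStarSubalgebra.isClosed_topologicalClosure _)

/-- The usual partial order of a `C*`-algebra. -/
instance : PartialOrder (CoeffAlgebra B) := CStarAlgebra.spectralOrder _

instance : StarOrderedRing (CoeffAlgebra B) := CStarAlgebra.spectralOrderedRing _

variable {B}

/-- `χ_A` as an element of `𝒜(B, L, θ)`. -/
def chi (A : B) : CoeffAlgebra B :=
  ⟨chi₀ A, NonUnitalStarSubalgebra.le_topologicalClosure _
    (NonUnitalStarAlgebra.subset_adjoin ℂ _ ⟨A, rfl⟩)⟩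

lemma chi_mul (A A' : B) : chi A * chi A' = chi (A ⊓ A') := Subtype.ext (chi₀_mul A A')

lemma star_chi (A : B) : star (chi A) = chi A := Subtype.ext (star_chi₀ A)

/-- The `*`-homomorphism of `𝒜(B, L, θ)` determined by `χ_A ↦ χ_{θ_α(A)}`: the restriction of
`BooleanAction.pullHom`. -/
def BooleanAction.coeffHom (h : BooleanAction B) : CoeffAlgebra B →⋆ₙₐ[ℂ] CoeffAlgebra B :=
  NonUnitalStarAlgHom.codRestrict
    (h.pullHom.comp (NonUnitalStarSubalgebraClass.subtype (coeffSubalgebra B)))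
    (coeffSubalgebra B) (fun f => by
      have hc : Continuous h.pullHom := by
        open scoped CStarAlgebra in exact map_continuous h.pullHom
      have h1 := NonUnitalStarSubalgebra.map_topologicalClosure_le
        (s := NonUnitalStarAlgebra.adjoin ℂ (Set.range (chi₀ (B := B)))) hc
      refine NonUnitalStarSubalgebra.topologicalClosure_mono ?_ (h1 ⟨f.1, f.2, rfl⟩)
      refine NonUnitalStarSubalgebra.map_le.2 (NonUnitalStarAlgebra.adjoin_le ?_)
      rintro _ ⟨A, rfl⟩
      exact NonUnitalStarAlgebra.subset_adjoin ℂ _ ⟨h.toFun A, (h.pullHom_chi₀ A).symm⟩)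

lemma BooleanAction.coeffHom_chi (h : BooleanAction B) (A : B) :
    h.coeffHom (chi A) = chi (h.toFun A) := Subtype.ext (h.pullHom_chi₀ A)

lemma coeff_induction {p : CoeffAlgebra B → Prop} (hclosed : IsClosed {f | p f})
    (chi : ∀ A, p (chi A)) (zero : p 0) (add : ∀ f g, p f → p g → p (f + g))
    (smul : ∀ (c : ℂ) f, p f → p (c • f)) (mul : ∀ f g, p f → p g → p (f * g))
    (star : ∀ f, p f → p (star f)) (f : CoeffAlgebra B) : p f := by
  let T : Set C₀(StoneDual B, ℂ) := {g | ∃ hg : g ∈ coeffSubalgebra B, p ⟨g, hg⟩}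
  have hT : IsClosed T := by
    have h1 : IsClosed (coeffSubalgebra B : Set C₀(StoneDual B, ℂ)) :=
      NonUnitalStarSubalgebra.isClosed_topologicalClosure _
    have h2 : T = Subtype.val '' {f : coeffSubalgebra B | p f} := by
      ext g
      simp only [T, Set.mem_ofPred_eq, Set.mem_image, Subtype.exists, exists_and_right,
        exists_eq_right]
      rfl
    rw [h2]
    exact h1.isClosedMap_subtype_val _ hclosed
  have hsub : (NonUnitalStarAlgebra.adjoin ℂ (Set.range (chi₀ (B := B))) :
      Set C₀(StoneDual B, ℂ)) ⊆ T := by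
    intro g hg
    induction hg using NonUnitalStarAlgebra.adjoin_induction with
    | mem g hg =>
      obtain ⟨A, rfl⟩ := hg
      exact ⟨_, chi A⟩
    | add g g' _ _ h h' => exact ⟨_, add _ _ h.2 h'.2⟩
    | zero => exact ⟨_, zero⟩
    | mul g g' _ _ h h' => exact ⟨_, mul _ _ h.2 h'.2⟩
    | smul c g _ h => exact ⟨_, smul c _ h.2⟩
    | star g _ h => exact ⟨_, star _ h.2⟩
  exact (closure_minimal hsub hT f.2).2

/-- The closed linear span of `{χ_A : A ∈ I}`, for an ideal `I` of `B`. -/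
def idealSpan (I : Order.Ideal B) : Submodule ℂ (CoeffAlgebra B) :=
  (Submodule.span ℂ (chi '' (I : Set B))).topologicalClosure

lemma isClosed_idealSpan (I : Order.Ideal B) : IsClosed (idealSpan I : Set (CoeffAlgebra B)) :=
  Submodule.isClosed_topologicalClosure _

lemma chi_mem_idealSpan {I : Order.Ideal B} {A : B} (hA : A ∈ I) : chi A ∈ idealSpan I :=
  Submodule.le_topologicalClosure _ (Submodule.subset_span ⟨A, hA, rfl⟩)

lemma mul_mem_idealSpan (I : Order.Ideal B) (f : CoeffAlgebra B) {x : CoeffAlgebra B}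
    (hx : x ∈ idealSpan I) : f * x ∈ idealSpan I := by
  suffices h : ∀ f : CoeffAlgebra B, (∀ x ∈ idealSpan I, f * x ∈ idealSpan I) ∧
      ∀ x ∈ idealSpan I, star f * x ∈ idealSpan I from (h f).1 x hx
  clear hx x f
  have hchi : ∀ A : B, ∀ x ∈ idealSpan I, chi A * x ∈ idealSpan I := by
    intro A x hx
    have hc : IsClosed {x : CoeffAlgebra B | chi A * x ∈ idealSpan I} :=
      (isClosed_idealSpan I).preimage (continuous_const_mul (chi A))
    refine closure_minimal ?_ hc hx
    intro y hy
    change chi A * y ∈ idealSpan I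
    induction hy using Submodule.span_induction with
    | mem y hy =>
      obtain ⟨A', hA', rfl⟩ := hy
      rw [chi_mul]
      exact chi_mem_idealSpan (I.lower inf_le_right hA')
    | zero => rw [mul_zero]; exact Submodule.zero_mem _
    | add y y' _ _ h h' => rw [mul_add]; exact Submodule.add_mem _ h h'
    | smul c y _ h => rw [mul_smul_comm]; exact Submodule.smul_mem _ c h
  refine coeff_induction ?_ ?_ ?_ ?_ ?_ ?_ ?_
  · simp only [Set.ofPred_and, Set.ofPred_forall]
    exact (isClosed_iInter fun x => isClosed_iInter fun _ =>
      (isClosed_idealSpan I).preimage (continuous_mul_const x)).inter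
      (isClosed_iInter fun x => isClosed_iInter fun _ =>
      (isClosed_idealSpan I).preimage ((continuous_mul_const x).comp continuous_star))
  · exact fun A => ⟨hchi A, by rw [star_chi]; exact hchi A⟩
  · simp
  · intro f g hf hg
    refine ⟨fun x hx => ?_, fun x hx => ?_⟩
    · rw [add_mul]; exact Submodule.add_mem _ (hf.1 x hx) (hg.1 x hx)
    · rw [star_add, add_mul]; exact Submodule.add_mem _ (hf.2 x hx) (hg.2 x hx)
  · intro c f hf
    refine ⟨fun x hx => ?_, fun x hx => ?_⟩
    · rw [smul_mul_assoc]; exact Submodule.smul_mem _ _ (hf.1 x hx)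
    · rw [star_smul, smul_mul_assoc]; exact Submodule.smul_mem _ _ (hf.2 x hx)
  · intro f g hf hg
    refine ⟨fun x hx => ?_, fun x hx => ?_⟩
    · rw [mul_assoc]; exact hf.1 _ (hg.1 x hx)
    · rw [star_mul, mul_assoc]; exact hg.2 _ (hf.2 x hx)
  · intro f hf
    exact ⟨hf.2, by rw [star_star]; exact hf.1⟩

lemma star_mem_idealSpan (I : Order.Ideal B) {x : CoeffAlgebra B} (hx : x ∈ idealSpan I) :
    star x ∈ idealSpan I := by
  refine closure_minimal ?_ ((isClosed_idealSpan I).preimage continuous_star) hx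
  intro y hy
  change star y ∈ idealSpan I
  induction hy using Submodule.span_induction with
  | mem y hy =>
    obtain ⟨A', hA', rfl⟩ := hy
    rw [star_chi]
    exact chi_mem_idealSpan hA'
  | zero => rw [star_zero]; exact Submodule.zero_mem _
  | add y y' _ _ h h' => rw [star_add]; exact Submodule.add_mem _ h h'
  | smul c y _ h => rw [star_smul]; exact Submodule.smul_mem _ _ h

end CoeffAlgebra

/-! ### Summability in a `C*`-algebra -/

section Summable

variable {A : Type u} {L : Type v} [NonUnitalCStarAlgebra A] [PartialOrder A] [StarOrderedRing A]

lemma summable_of_nonneg_of_le {a b : L → A} (ha : ∀ i, 0 ≤ a i) (hab : ∀ i, a i ≤ b i)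
    (hb : Summable b) : Summable a := by
  rw [summable_iff_vanishing_norm] at hb ⊢
  intro ε hε
  obtain ⟨s, hs⟩ := hb ε hε
  exact ⟨s, fun t ht => (CStarAlgebra.norm_le_norm_of_nonneg_of_le
    (Finset.sum_nonneg fun i _ => ha i) (Finset.sum_le_sum fun i _ => hab i)).trans_lt (hs t ht)⟩

lemma summable_star_mul_add {x y : L → A} (hx : Summable fun i => star (x i) * x i)
    (hy : Summable fun i => star (y i) * y i) :
    Summable fun i => star (x i + y i) * (x i + y i) := by
  refine summable_of_nonneg_of_le (b := fun i => (2 : ℂ) • (star (x i) * x i + star (y i) * y i))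
    (fun i => star_mul_self_nonneg _) (fun i => ?_) ((hx.add hy).const_smul _)
  rw [← sub_nonneg]
  have h : (2 : ℂ) • (star (x i) * x i + star (y i) * y i) - star (x i + y i) * (x i + y i)
      = star (x i - y i) * (x i - y i) := by
    simp only [star_add, star_sub, add_mul, mul_add, sub_mul, mul_sub, two_smul]
    abel
  rw [h]
  exact star_mul_self_nonneg _

lemma summable_star_mul_smul {x : L → A} (hx : Summable fun i => star (x i) * x i) (c : ℂ) :
    Summable fun i => star (c • x i) * (c • x i) := by
  simp only [star_smul, smul_mul_assoc, mul_smul_comm]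
  exact (hx.const_smul _).const_smul _

lemma summable_star_mul {x y : L → A} (hx : Summable fun i => star (x i) * x i)
    (hy : Summable fun i => star (y i) * y i) : Summable fun i => star (x i) * y i := by
  have h1 := summable_star_mul_add hx hy
  have h2 := summable_star_mul_add hx (summable_star_mul_smul hy (-1))
  have h3 := summable_star_mul_add hx (summable_star_mul_smul hy Complex.I)
  have h4 := summable_star_mul_add hx (summable_star_mul_smul hy (-Complex.I))
  have h := (((h1.sub h2).sub (h3.const_smul Complex.I)).add (h4.const_smul Complex.I)).const_smul
    (1 / 4 : ℂ)
  refine h.congr fun i => ?_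
  simp only [star_add, star_smul, add_mul, mul_add, smul_mul_assoc, mul_smul_comm, smul_add,
    smul_smul, smul_sub, Complex.star_def, map_neg, map_one, Complex.conj_I]
  ring_nf
  simp only [Complex.I_sq]
  module

lemma star_mul_mul_le {c : ℝ} (g x : A) (hg : ‖g‖ ≤ c) :
    star (g * x) * (g * x) ≤ (c ^ 2) • (star x * x) := by
  calc star (g * x) * (g * x) = star x * (star g * g) * x := by
        simp only [star_mul, mul_assoc]
    _ ≤ ‖star g * g‖ • (star x * x) :=
        CStarAlgebra.star_left_conjugate_le_norm_smul (hb := IsSelfAdjoint.star_mul_self _)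
    _ ≤ (c ^ 2) • (star x * x) := by
        rw [CStarRing.norm_star_mul_self, ← sq]
        refine smul_le_smul_of_nonneg_right ?_ (star_mul_self_nonneg _)
        exact pow_le_pow_left₀ (norm_nonneg _) hg 2

lemma summable_star_mul_mul {x g : L → A} (hx : Summable fun i => star (x i) * x i) (c : ℝ)
    (hg : ∀ i, ‖g i‖ ≤ c) : Summable fun i => star (g i * x i) * (g i * x i) :=
  summable_of_nonneg_of_le (fun _ => star_mul_self_nonneg _)
    (fun i => star_mul_mul_le (g i) (x i) (hg i)) (hx.const_smul (c ^ 2))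

end Summable

/-! ### The `C*`-correspondence `X(B, L, θ, I_α)` -/

namespace GeneralizedBooleanDynamicalSystem

section Corr

variable {B : Type u} {L : Type v} [GeneralizedBooleanAlgebra B]
  (S : GeneralizedBooleanDynamicalSystem B L)

/-- `φ_α : 𝒜(B, L, θ) → 𝒜(B, L, θ)`, with `φ_α(χ_A) = χ_{θ_α(A)}`; its range lies in `X_α`. -/
def φc (α : L) : CoeffAlgebra B →⋆ₙₐ[ℂ] CoeffAlgebra B := (S.action α).coeffHom

lemma φc_chi (α : L) (A : B) : S.φc α (chi A) = chi (S.θ α A) :=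
  (S.action α).coeffHom_chi A

lemma norm_φc_le (α : L) (f : CoeffAlgebra B) : ‖S.φc α f‖ ≤ ‖f‖ :=
  NonUnitalStarAlgHom.norm_apply_le (S.φc α) f

/-- `X_α`, the closed span of `{χ_A : A ∈ I_α}`. -/
def Xc (α : L) : Submodule ℂ (CoeffAlgebra B) := idealSpan (S.I α)

lemma φc_mem_Xc (α : L) (f : CoeffAlgebra B) : S.φc α f ∈ S.Xc α := by
  have hc : Continuous (S.φc α) := by
    open scoped CStarAlgebra in exact map_continuous (S.φc α)
  refine coeff_induction (p := fun f => S.φc α f ∈ S.Xc α)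
    ((isClosed_idealSpan (S.I α)).preimage hc) (fun A => ?_) ?_ (fun f g hf hg => ?_)
    (fun c f hf => ?_) (fun f g _ hg => ?_) (fun f hf => ?_) f
  · rw [φc_chi]
    exact chi_mem_idealSpan (S.θI α A).2
  · rw [map_zero]
    exact Submodule.zero_mem _
  · rw [map_add]
    exact Submodule.add_mem _ hf hg
  · rw [map_smul]
    exact Submodule.smul_mem _ c hf
  · rw [map_mul]
    exact mul_mem_idealSpan _ _ hg
  · rw [map_star]
    exact star_mem_idealSpan _ hf

/-- The family `(x_α) ∈ ∏ X_α` such that `∑ x_α* x_α` converges. -/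
def XSubmodule : Submodule ℂ (L → CoeffAlgebra B) where
  carrier := {x | (∀ α, x α ∈ S.Xc α) ∧ Summable fun α => star (x α) * x α}
  zero_mem' := ⟨fun α => Submodule.zero_mem _, by simp⟩
  add_mem' hx hy := ⟨fun α => Submodule.add_mem _ (hx.1 α) (hy.1 α),
    summable_star_mul_add hx.2 hy.2⟩
  smul_mem' c _ hx := ⟨fun α => Submodule.smul_mem _ c (hx.1 α), summable_star_mul_smul hx.2 c⟩

/-- The Hilbert module `X(B, L, θ, I_α) = ⊕ X_α`. -/
def X : Type (max u v) := S.XSubmodule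

instance : AddCommGroup S.X := inferInstanceAs (AddCommGroup S.XSubmodule)

instance : Module ℂ S.X := inferInstanceAs (Module ℂ S.XSubmodule)

variable {S} in
/-- The coordinate `x_α`. -/
def X.coord (x : S.X) (α : L) : CoeffAlgebra B := x.1 α

variable {S} in
@[ext]
lemma X.ext {x y : S.X} (h : ∀ α, x.coord α = y.coord α) : x = y := Subtype.ext (funext h)

variable {S} in
@[simp]
lemma X.coord_add (x y : S.X) (α : L) : (x + y).coord α = x.coord α + y.coord α := rfl

variable {S} in
@[simp]
lemma X.coord_zero (α : L) : (0 : S.X).coord α = 0 := rfl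

variable {S} in
@[simp]
lemma X.coord_smul (c : ℂ) (x : S.X) (α : L) : (c • x).coord α = c • x.coord α := rfl

variable {S} in
lemma X.summable (x y : S.X) : Summable fun α => star (x.coord α) * y.coord α :=
  summable_star_mul x.2.2 y.2.2

/-- Coordinatewise multiplication by a bounded family in `𝒜(B, L, θ)`. -/
def mulX (g : L → CoeffAlgebra B) (c : ℝ) (hg : ∀ α, ‖g α‖ ≤ c) (x : S.X) : S.X :=
  ⟨fun α => g α * x.coord α, fun α => mul_mem_idealSpan _ _ (x.2.1 α),
    summable_star_mul_mul x.2.2 c hg⟩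

/-- The module action `x · f = (x_α f)_α`. -/
instance : SMul (CoeffAlgebra B) S.X :=
  ⟨fun f x => S.mulX (fun _ => f) ‖f‖ (fun _ => le_rfl) x⟩

@[simp]
lemma X.coord_coeff_smul (f : CoeffAlgebra B) (x : S.X) (α : L) :
    (f • x).coord α = x.coord α * f := mul_comm _ _

/-- The inner product `⟨x, y⟩ = ∑ x_α* y_α`. -/
instance : Inner (CoeffAlgebra B) S.X := ⟨fun x y => ∑' α, star (x.coord α) * y.coord α⟩

lemma X.inner_def (x y : S.X) : ⟪x, y⟫_(CoeffAlgebra B) = ∑' α, star (x.coord α) * y.coord α := rfl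

/-- The norm `‖x‖ = ‖⟨x, x⟩‖^(1/2)`. -/
instance : Norm S.X := CStarModule.norm (CoeffAlgebra B)

instance : CStarModule (CoeffAlgebra B) S.X where
  inner_add_right {x y z} := by
    simp only [X.inner_def, X.coord_add, mul_add]
    exact (X.summable x y).tsum_add (X.summable x z)
  inner_self_nonneg {x} := tsum_nonneg fun α => star_mul_self_nonneg _
  inner_self {x} := by
    refine ⟨fun h => ?_, fun h => by simp [h, X.inner_def]⟩
    ext α
    refine (CStarRing.star_mul_self_eq_zero_iff _).1 (le_antisymm ?_ (star_mul_self_nonneg _))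
    rw [X.inner_def] at h
    exact ((X.summable x x).le_tsum α fun β _ => star_mul_self_nonneg _).trans_eq h
  inner_op_smul_right {f x y} := by
    simp only [X.inner_def, X.coord_coeff_smul, ← mul_assoc]
    rw [(X.summable x y).tsum_mul_right, mul_comm]
  inner_smul_right_complex {c x y} := by
    simp only [X.inner_def, X.coord_smul, mul_smul_comm]
    exact (X.summable x y).tsum_const_smul c
  star_inner x y := by
    simp only [X.inner_def]
    rw [tsum_star]
    exact tsum_congr fun α => by rw [star_mul, star_star]
  norm_eq_sqrt_norm_inner_self x := rfl

instance : NormedAddCommGroup S.X := NormedAddCommGroup.ofCore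
  (CStarModule.normedSpaceCore (CoeffAlgebra B) (E := S.X))

instance : NormedSpace ℂ S.X := NormedSpace.ofCore
  (CStarModule.normedSpaceCore (CoeffAlgebra B) (E := S.X))

/-- `e_{α,A} = (δ_{α,β} χ_A)_β` for `A ∈ I_α`. -/
def e (α : L) (A : S.I α) : S.X := by
  classical
  exact ⟨Pi.single α (chi (A : B)), fun β => by
    by_cases h : β = α
    · subst h
      rw [Pi.single_eq_same]
      exact chi_mem_idealSpan A.2
    · rw [Pi.single_eq_of_ne h]
      exact Submodule.zero_mem _,
    summable_of_ne_finset_zero (s := {α}) fun β hβ => by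
      rw [Pi.single_eq_of_ne (by simpa using hβ), mul_zero]⟩

/-- The operator `x ↦ (φ_α(f) x_α)_α` as a linear map. -/
def φLin (f : CoeffAlgebra B) : S.X →ₗ[ℂ] S.X where
  toFun := S.mulX (fun α => S.φc α f) ‖f‖ (fun α => S.norm_φc_le α f)
  map_add' x y := X.ext fun α => mul_add (S.φc α f) (x.coord α) (y.coord α)
  map_smul' c x := X.ext fun α => mul_smul_comm c (S.φc α f) (x.coord α)

lemma coord_φLin (f : CoeffAlgebra B) (x : S.X) (α : L) :
    (S.φLin f x).coord α = S.φc α f * x.coord α := rfl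

lemma norm_φLin_le (f : CoeffAlgebra B) (x : S.X) : ‖S.φLin f x‖ ≤ ‖f‖ * ‖x‖ := by
  refine abs_le_of_sq_le_sq' ?_
    (mul_nonneg (norm_nonneg _) (CStarModule.norm_nonneg (CoeffAlgebra B))) |>.2
  rw [mul_pow, CStarModule.norm_sq_eq (CoeffAlgebra B) (x := S.φLin f x),
    CStarModule.norm_sq_eq (CoeffAlgebra B) (x := x)]
  have h : ⟪S.φLin f x, S.φLin f x⟫_(CoeffAlgebra B) ≤ (‖f‖ ^ 2) • ⟪x, x⟫_(CoeffAlgebra B) := by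
    rw [X.inner_def, X.inner_def, ← (X.summable x x).tsum_const_smul]
    refine (X.summable _ _).tsum_le_tsum (fun α => ?_) ((X.summable x x).const_smul _)
    rw [coord_φLin]
    exact star_mul_mul_le _ _ (S.norm_φc_le α f)
  calc ‖⟪S.φLin f x, S.φLin f x⟫_(CoeffAlgebra B)‖ ≤ ‖(‖f‖ ^ 2) • ⟪x, x⟫_(CoeffAlgebra B)‖ :=
        CStarAlgebra.norm_le_norm_of_nonneg_of_le
          (by rw [X.inner_def]; exact tsum_nonneg fun α => star_mul_self_nonneg _) h
    _ = ‖f‖ ^ 2 * ‖⟪x, x⟫_(CoeffAlgebra B)‖ := by rw [norm_smul]; simp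

/-- The operator `x ↦ (φ_α(f) x_α)_α` as a bounded operator. -/
def φCLM (f : CoeffAlgebra B) : S.X →L[ℂ] S.X :=
  (S.φLin f).mkContinuous ‖f‖ (S.norm_φLin_le f)

lemma coord_φCLM (f : CoeffAlgebra B) (x : S.X) (α : L) :
    (S.φCLM f x).coord α = S.φc α f * x.coord α := rfl

/-- The left action `φ : 𝒜(B, L, θ) → 𝔏(X)`, `φ(f) (x_α)_α = (φ_α(f) x_α)_α`. -/
def φ : CoeffAlgebra B →⋆ₙₐ[ℂ] Adjointable (CoeffAlgebra B) S.X where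
  toFun f :=
    { toCLM := S.φCLM f
      adj := S.φCLM (star f)
      inner_apply := fun x y => by
        simp only [X.inner_def, coord_φCLM, map_star, star_mul, star_star]
        exact tsum_congr fun α => by
          rw [← mul_assoc, mul_comm (star (x.coord α))] }
  map_smul' c f := by
    ext x α
    exact (congrArg (· * x.coord α) (map_smul (S.φc α) c f)).trans (smul_mul_assoc _ _ _)
  map_zero' := by
    ext x α
    exact (congrArg (· * x.coord α) (map_zero (S.φc α))).trans (zero_mul _)
  map_add' f g := by
    ext x α
    exact (congrArg (· * x.coord α) (map_add (S.φc α) f g)).trans (add_mul _ _ _)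
  map_mul' f g := by
    ext x α
    exact (congrArg (· * x.coord α) (map_mul (S.φc α) f g)).trans (mul_assoc _ _ _)
  map_star' f := Adjointable.ext fun _ => rfl

lemma φ_apply_coord (f : CoeffAlgebra B) (x : S.X) (α : L) :
    ((S.φ f).toCLM x).coord α = S.φc α f * x.coord α := rfl

end Corr

end GeneralizedBooleanDynamicalSystem

/-! ### Representations of relative generalized Boolean dynamical systems -/

namespace RelativeBooleanDynamicalSystem

variable {B : Type u} {L : Type v} [GeneralizedBooleanAlgebra B]
  (S : RelativeBooleanDynamicalSystem B L)

/-- `K_J`, the ideal of `𝒜(B, L, θ)` given by the closed span of `{χ_A : A ∈ J}`. -/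
def K : Set (CoeffAlgebra B) := idealSpan S.J

/-- A `(B, L, θ, I_α; J)`-representation `{P_A, S_{α,B}}` in `𝒳`: projections `P_A` for `A ∈ B`
and partial isometries `S_{α,C}` for `α ∈ L`, `C ∈ I_α`, subject to the relations (i)–(iv).
The sum in the last relation is finite, as `J` consists of regular elements. -/
structure IsRepresentation {𝒳 : Type w} [NonUnitalCStarAlgebra 𝒳]
    (P : B → 𝒳) (s : ∀ α : L, S.I α → 𝒳) : Prop where
  isStarProjection : ∀ A, IsStarProjection (P A)
  isPartialIsometry : ∀ α C, s α C * star (s α C) * s α C = s α C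
  map_bot : P ⊥ = 0
  map_inf : ∀ A A', P (A ⊓ A') = P A * P A'
  map_sup : ∀ A A', P (A ⊔ A') = P A + P A' - P (A ⊓ A')
  P_mul_s : ∀ A α C, P A * s α C = s α C * P (S.θ α A)
  star_s_mul_s : ∀ α (C C' : S.I α), star (s α C) * s α C' = P ((C : B) ⊓ C')
  star_s_mul_s_of_ne : ∀ α α' (C : S.I α) (C' : S.I α'), α ≠ α' → star (s α C) * s α' C' = 0
  P_eq_sum : ∀ A ∈ S.J, P A = ∑ᶠ α ∈ S.Δ A, s α (S.θI α A) * star (s α (S.θI α A))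

/-- `{p_A, s_{α,C}}` exhibits `𝒰` as `C*(B, L, θ, I_α; J)`: it is a universal
`(B, L, θ, I_α; J)`-representation, and `𝒰` is generated by it. -/
structure IsUniversalRepresentation {𝒰 : Type w} [NonUnitalCStarAlgebra 𝒰]
    (p : B → 𝒰) (s : ∀ α : L, S.I α → 𝒰) : Prop where
  isRepresentation : S.IsRepresentation p s
  generates : (NonUnitalStarAlgebra.adjoin ℂ
    (Set.range p ∪ {x | ∃ α C, x = s α C})).topologicalClosure = ⊤
  universal : ∀ (𝒳 : Type w) [NonUnitalCStarAlgebra 𝒳] (P : B → 𝒳) (T : ∀ α : L, S.I α → 𝒳),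
    S.IsRepresentation P T →
      ∃! Φ : 𝒰 →⋆ₙₐ[ℂ] 𝒳, (∀ A, Φ (p A) = P A) ∧ ∀ α C, Φ (s α C) = T α C

end RelativeBooleanDynamicalSystem

end RelBoolSys

end

open RelBoolSys

noncomputable section

namespace RelBoolSys

/-! ### Extension of maps from families with dense span -/

section Extension

variable {ι : Type*} {C : Type*} {D : Type*}

/-! Everything is determined by generators. The span of the `χ_A` is dense in the coefficient
algebra (`mem_closure_span_chi`) and the span of the `e_{α,C}` is dense in `X`
(`mem_closure_span_e`), so a representation `(π, t)` is determined by the family that it induces;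
this is injectivity. The relations (i)–(iv) follow from identities in `X`: products of the `χ_A`
give (i), `φ(χ_A) e_{α,C} = e_{α,C} · χ_{θ_α(A)}` gives (ii), the inner products of the `e_{α,C}`
give (iii). For `A ∈ J` the set `Δ_A` is finite and `φ(χ_A) = ∑ Θ_{e,e}` with `e = e_{α,θ_α(A)}`
(`φ_chi_eq_sum`), so (iv) says exactly that `(π, t)` is coisometric at `χ_A`.

Surjectivity requires extending maps from generators, hence norm estimates. For `π`, a linear
combination of the `χ_A` is rewritten over disjoint elements (`exists_disjoint_sum`); then both
norms can be compared coefficient by coefficient (`norm_sum_smul_le`, `exists_coeffHom`). For `t`,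
relation (iii) prescribes all inner products, and contractivity of `π` gives the bound
(`exists_clm_of_star_mul`). For `ψ_t`, the estimate on finite rank operators is a spectral radius
argument (`norm_le_of_isSelfAdjoint`). Once `ψ_t` is known to exist and to be continuous, coisometry
passes from the `χ_A` with `A ∈ J` to their closed span `K_J`.

The universal algebra is a norm-closed subalgebra of a bounded product of sufficiently many
representations (`exists_universal`). Under the bijection, a universal representation of the
dynamical system is a universal coisometric representation of `X` on the same algebra, and the
isomorphism is uniqueness of universal objects. -/

lemma exists_clm_of_norm_le [NormedAddCommGroup C] [NormedSpace ℂ C] [NormedAddCommGroup D]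
    [NormedSpace ℂ D] [CompleteSpace D] {a : ι → C} {b : ι → D}
    (hd : ∀ x : C, x ∈ (Submodule.span ℂ (Set.range a)).topologicalClosure)
    (hn : ∀ c : ι →₀ ℂ, ‖Finsupp.linearCombination ℂ b c‖ ≤ ‖Finsupp.linearCombination ℂ a c‖) :
    ∃ T : C →L[ℂ] D, (∀ i, T (a i) = b i) ∧ ∀ x, ‖T x‖ ≤ ‖x‖ := by
  have hdense : DenseRange (Finsupp.linearCombination ℂ a) := by
    intro x
    rw [← LinearMap.coe_range, Finsupp.range_linearCombination]
    exact hd x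
  have hn' : ∀ c : ι →₀ ℂ,
      ‖Finsupp.linearCombination ℂ b c‖ ≤ 1 * ‖Finsupp.linearCombination ℂ a c‖ := by
    simpa using hn
  refine ⟨(Finsupp.linearCombination ℂ b).extendOfNorm (Finsupp.linearCombination ℂ a),
    fun i => ?_, fun x => ?_⟩
  · simpa using LinearMap.extendOfNorm_eq hdense ⟨1, hn'⟩ (Finsupp.single i 1)
  · simpa using LinearMap.norm_extendOfNorm_apply_le hdense 1 hn' x

/-- Induction over a family with dense span. -/
lemma dense_span_induction [NormedAddCommGroup C] [NormedSpace ℂ C] {a : ι → C}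
    (hd : ∀ x : C, x ∈ (Submodule.span ℂ (Set.range a)).topologicalClosure) {p : C → Prop}
    (hclosed : IsClosed {x | p x}) (mem : ∀ i, p (a i)) (zero : p 0)
    (add : ∀ x y, p x → p y → p (x + y)) (smul : ∀ (c : ℂ) x, p x → p (c • x)) (x : C) : p x := by
  refine closure_minimal ?_ hclosed (hd x)
  intro y hy
  change p y
  induction hy using Submodule.span_induction with
  | mem y hy => obtain ⟨i, rfl⟩ := hy; exact mem i
  | zero => exact zero
  | add y y' _ _ h h' => exact add _ _ h h'
  | smul c y _ h => exact smul _ _ h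

/-- Both families are closed under products and adjoints with the same index on either side, so the
continuous linear extension respects these operations on the family, and by density everywhere. -/
lemma exists_starHom_of_norm_le [NonUnitalNormedRing C] [StarRing C] [NormedStarGroup C]
    [NormedSpace ℂ C] [IsScalarTower ℂ C C] [SMulCommClass ℂ C C] [StarModule ℂ C]
    [NonUnitalCStarAlgebra D] {a : ι → C} {b : ι → D}
    (hd : ∀ x : C, x ∈ (Submodule.span ℂ (Set.range a)).topologicalClosure)
    (hn : ∀ c : ι →₀ ℂ, ‖Finsupp.linearCombination ℂ b c‖ ≤ ‖Finsupp.linearCombination ℂ a c‖)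
    (hmul : ∀ i j, ∃ k, a i * a j = a k ∧ b i * b j = b k)
    (hstar : ∀ i, ∃ k, star (a i) = a k ∧ star (b i) = b k) :
    ∃ T : C →⋆ₙₐ[ℂ] D, (∀ i, T (a i) = b i) ∧ ∀ x, ‖T x‖ ≤ ‖x‖ := by
  obtain ⟨T, hT, hle⟩ := exists_clm_of_norm_le hd hn
  have hm : ∀ x y, T (x * y) = T x * T y := by
    intro x y
    refine dense_span_induction hd (p := fun x => T (x * y) = T x * T y) ?_ ?_ ?_ ?_ ?_ x
    · exact isClosed_eq (by fun_prop) (by fun_prop)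
    · intro i
      refine dense_span_induction hd (p := fun y => T (a i * y) = T (a i) * T y) ?_ ?_ ?_ ?_ ?_ y
      · exact isClosed_eq (by fun_prop) (by fun_prop)
      · intro j
        obtain ⟨k, hk, hk'⟩ := hmul i j
        rw [hk, hT, hT, hT, hk']
      · simp
      · intro y y' h h'
        rw [mul_add, map_add, h, h', map_add, mul_add]
      · intro c y h
        rw [mul_smul_comm, map_smul, h, map_smul, mul_smul_comm]
    · simp
    · intro y y' h h'
      rw [add_mul, map_add, h, h', map_add, add_mul]
    · intro c y h
      rw [smul_mul_assoc, map_smul, h, map_smul, smul_mul_assoc]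
  have hs : ∀ x, T (star x) = star (T x) := by
    refine dense_span_induction hd ?_ ?_ ?_ ?_ ?_
    · exact isClosed_eq (by fun_prop) (by fun_prop)
    · intro i
      obtain ⟨k, hk, hk'⟩ := hstar i
      rw [hk, hT, hT, hk']
    · simp
    · intro y y' h h'
      rw [star_add, map_add, h, h', map_add, star_add]
    · intro c y h
      rw [star_smul, map_smul, h, map_smul, star_smul]
  exact ⟨⟨⟨⟨⟨T, map_smul T⟩, map_zero T, map_add T⟩, hm⟩, hs⟩, hT, hle⟩

end Extension

/-! ### The representation of the compact operators induced by a representation -/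

section Compacts

variable {A : Type u} {E : Type v} [NonUnitalCommCStarAlgebra A] [PartialOrder A]
  [StarOrderedRing A] [NormedAddCommGroup E] [NormedSpace ℂ E] [SMul A E] [CStarModule A E]
  {φ : A →⋆ₙₐ[ℂ] Adjointable A E} {𝒳 : Type w} [NonUnitalCStarAlgebra 𝒳]

/-- The difference `d` of the two sides satisfies `d* d = 0`: expanding `d* d` gives four terms,
each equal up to sign to the image under `π` of the same product of `f*`, `⟨x, x⟩` and `f`. Right
linearity is therefore automatic, even for a map `t` not assumed linear. -/
lemma map_smul_of_star_mul {π : A →⋆ₙₐ[ℂ] 𝒳} {t : E → 𝒳}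
    (h : ∀ x y, star (t x) * t y = π ⟪x, y⟫_A) (f : A) (x : E) : t (f • x) = t x * π f := by
  rw [← sub_eq_zero, ← CStarRing.star_mul_self_eq_zero_iff]
  have hs : star (t x * π f) = π (star f) * star (t x) := by rw [star_mul, map_star]
  rw [star_sub, hs, sub_mul, mul_sub, mul_sub, ← mul_assoc, h, h,
    mul_assoc (π (star f)), h, mul_assoc (π (star f)), ← mul_assoc (star (t x)),
    h, ← map_mul, ← map_mul, ← map_mul, ← map_mul,
    CStarModule.inner_op_smul_right, CStarModule.inner_op_smul_left,
    CStarModule.inner_op_smul_right, mul_comm _ f, mul_comm _ f, mul_left_comm f,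
    sub_self, sub_self, sub_self]

/-- A map of a Hilbert module can be prescribed on a family with dense span, subject to
compatibility with the inner products. -/
lemma exists_clm_of_star_mul {π : A →⋆ₙₐ[ℂ] 𝒳} {ι : Type*} {a : ι → E} {b : ι → 𝒳}
    (hd : ∀ x : E, x ∈ (Submodule.span ℂ (Set.range a)).topologicalClosure)
    (hb : ∀ i j, star (b i) * b j = π ⟪a i, a j⟫_A) :
    ∃ t : E →L[ℂ] 𝒳, (∀ i, t (a i) = b i) ∧ ∀ x y, star (t x) * t y = π ⟪x, y⟫_A := by
  have hlc : ∀ c d : ι →₀ ℂ,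
      star (Finsupp.linearCombination ℂ b c) * Finsupp.linearCombination ℂ b d =
        π ⟪Finsupp.linearCombination ℂ a c, Finsupp.linearCombination ℂ a d⟫_A := by
    intro c d
    induction c using Finsupp.induction_linear with
    | zero => simp
    | add c c' hc hc' =>
      rw [map_add, map_add, star_add, add_mul, hc, hc', CStarModule.inner_add_left, map_add]
    | single q z =>
      induction d using Finsupp.induction_linear with
      | zero => simp
      | add d d' hd hd' =>
        rw [map_add, map_add, mul_add, hd, hd', CStarModule.inner_add_right, map_add]
      | single r y =>
        rw [Finsupp.linearCombination_single, Finsupp.linearCombination_single,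
          Finsupp.linearCombination_single, Finsupp.linearCombination_single, star_smul,
          smul_mul_smul_comm, hb, CStarModule.inner_smul_left_complex,
          CStarModule.inner_smul_right_complex, smul_smul, map_smul]
  -- For equal coefficient vectors `hlc` says that the squared norm in `𝒳` is `‖π⟨x, x⟩‖`, which is
  -- at most `‖⟨x, x⟩‖ = ‖x‖²`.
  obtain ⟨t, ht, -⟩ := exists_clm_of_norm_le (b := b) hd
    (fun c => by
      refine abs_le_of_sq_le_sq' ?_ (norm_nonneg _) |>.2
      rw [sq, ← CStarRing.norm_star_mul_self, hlc, CStarModule.norm_sq_eq A]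
      exact NonUnitalStarAlgHom.norm_apply_le π _)
  have hπc : Continuous π := by
    open scoped CStarAlgebra in exact map_continuous π
  refine ⟨t, ht, fun x y => ?_⟩
  refine dense_span_induction hd (p := fun x => star (t x) * t y = π ⟪x, y⟫_A) ?_ ?_ ?_ ?_ ?_ x
  · exact isClosed_eq (by fun_prop) (hπc.comp
      (CStarModule.continuous_inner.comp (continuous_id.prodMk continuous_const)))
  · intro q
    refine dense_span_induction hd
      (p := fun y => star (t (a q)) * t y = π ⟪a q, y⟫_A) ?_ ?_ ?_ ?_ ?_ y
    · exact isClosed_eq (by fun_prop) (hπc.comp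
        (CStarModule.continuous_inner.comp (continuous_const.prodMk continuous_id)))
    · intro r
      rw [ht, ht, hb]
    · simp
    · intro y y' hy hy'
      rw [map_add, mul_add, hy, hy', CStarModule.inner_add_right, map_add]
    · intro c y hy
      rw [map_smul, mul_smul_comm, hy, CStarModule.inner_smul_right_complex, map_smul]
  · simp
  · intro y y' hy hy'
    rw [map_add, star_add, add_mul, hy, hy', CStarModule.inner_add_left, map_add]
  · intro c y hy
    rw [map_smul, star_smul, smul_mul_assoc, hy, CStarModule.inner_smul_left_complex, map_smul]

/-! ### Norm estimates for the correspondence `Θ_{x,y} ↦ t(x) t(y)*`. -/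

namespace ToeplitzRep

variable (ρ : ToeplitzRep φ 𝒳)

lemma norm_t_le (x : E) : ‖ρ.t x‖ ≤ ‖x‖ := by
  refine abs_le_of_sq_le_sq' ?_ (norm_nonneg _) |>.2
  rw [sq, ← CStarRing.norm_star_mul_self, ρ.star_t_mul_t, CStarModule.norm_sq_eq A]
  exact NonUnitalStarAlgHom.norm_apply_le ρ.π _

lemma continuous_t : Continuous ρ.t :=
  AddMonoidHomClass.continuous_of_bound ρ.t 1 fun x => by
    rw [one_mul]
    exact ρ.norm_t_le x

lemma t_smul (f : A) (x : E) : ρ.t (f • x) = ρ.t x * ρ.π f :=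
  map_smul_of_star_mul ρ.star_t_mul_t f x

/-- The graph of the map `∑ Θ_{x,y} ↦ ∑ t(x) t(y)*`. -/
def compactGraph : Submodule ℂ (Adjointable A E × 𝒳) :=
  Submodule.span ℂ (Set.range fun q : E × E => (Theta A q.1 q.2, ρ.t q.1 * star (ρ.t q.2)))

lemma Theta_mem_compactGraph (x y : E) :
    (Theta A x y, ρ.t x * star (ρ.t y)) ∈ ρ.compactGraph :=
  Submodule.subset_span ⟨(x, y), rfl⟩

/-- On the range of `t` the second component acts as the first one acts on `E`. This links the two
components of a pair before the second is known to be a function of the first. -/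
lemma compactGraph_mul_t {p : Adjointable A E × 𝒳} (hp : p ∈ ρ.compactGraph) (z : E) :
    p.2 * ρ.t z = ρ.t (p.1.toCLM z) := by
  induction hp using Submodule.span_induction with
  | mem p hp =>
    obtain ⟨q, rfl⟩ := hp
    change ρ.t q.1 * star (ρ.t q.2) * ρ.t z = ρ.t (⟪q.2, z⟫_A • q.1)
    rw [mul_assoc, ρ.star_t_mul_t, t_smul]
  | zero => exact (zero_mul _).trans (map_zero ρ.t).symm
  | add p p' _ _ h h' =>
    exact (add_mul _ _ _).trans ((congrArg₂ _ h h').trans (map_add ρ.t _ _).symm)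
  | smul c p _ h =>
    exact (smul_mul_assoc _ _ _).trans ((congrArg _ h).trans (map_smul ρ.t _ _).symm)

lemma star_mem_compactGraph {p : Adjointable A E × 𝒳} (hp : p ∈ ρ.compactGraph) :
    star p ∈ ρ.compactGraph := by
  induction hp using Submodule.span_induction with
  | mem p hp =>
    obtain ⟨q, rfl⟩ := hp
    refine Submodule.subset_span ⟨q.swap, Prod.ext rfl ?_⟩
    change _ = star (ρ.t q.1 * star (ρ.t q.2))
    rw [star_mul, star_star]
    rfl
  | zero => rw [star_zero]; exact Submodule.zero_mem _
  | add p p' _ _ h h' => rw [star_add]; exact Submodule.add_mem _ h h'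
  | smul c p _ h => rw [star_smul]; exact Submodule.smul_mem _ _ h

lemma Theta_mul_compactGraph {p : Adjointable A E × 𝒳} (hp : p ∈ ρ.compactGraph) (x y : E) :
    (Theta A x y, ρ.t x * star (ρ.t y)) * p =
      (Theta A x (p.1.adj y), ρ.t x * star (ρ.t (p.1.adj y))) := by
  refine Prod.ext (Theta_mul x y p.1) ?_
  have h := ρ.compactGraph_mul_t (ρ.star_mem_compactGraph hp) y
  change ρ.t x * star (ρ.t y) * p.2 = _
  change star p.2 * ρ.t y = ρ.t (p.1.adj y) at h
  rw [← h, star_mul, star_star, mul_assoc]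

lemma mul_mem_compactGraph {p q : Adjointable A E × 𝒳} (hp : p ∈ ρ.compactGraph)
    (hq : q ∈ ρ.compactGraph) : p * q ∈ ρ.compactGraph := by
  induction hp using Submodule.span_induction with
  | mem p hp =>
    obtain ⟨⟨x, y⟩, rfl⟩ := hp
    exact Submodule.subset_span ⟨(x, q.1.adj y), (ρ.Theta_mul_compactGraph hq x y).symm⟩
  | zero => rw [zero_mul]; exact Submodule.zero_mem _
  | add p p' _ _ h h' => rw [add_mul]; exact Submodule.add_mem _ h h'
  | smul c p _ h => rw [smul_mul_assoc]; exact Submodule.smul_mem _ _ h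

/-- If `p` comes from `∑ Θ_{x_i,y_i}`, then `p q` comes from `∑ Θ_{x_i,T* y_i}`, where `T` is the
first component of `q`, and `c = ∑ ‖x_i‖ ‖y_i‖` works. The constant depends on the chosen expression
of `p` but not on `q`, which is what allows `q` to run through powers of `p`. -/
lemma exists_norm_mul_le {p : Adjointable A E × 𝒳} (hp : p ∈ ρ.compactGraph) :
    ∃ c : ℝ, 0 ≤ c ∧ ∀ q ∈ ρ.compactGraph, ‖(p * q).2‖ ≤ c * ‖q.1‖ := by
  induction hp using Submodule.span_induction with
  | mem p hp =>
    obtain ⟨⟨x, y⟩, rfl⟩ := hp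
    refine ⟨‖x‖ * ‖y‖, by positivity, fun q hq => ?_⟩
    rw [ρ.Theta_mul_compactGraph hq]
    have h1 : ‖q.1.adj y‖ ≤ ‖q.1‖ * ‖y‖ := by
      rw [← norm_star q.1]
      exact (star q.1).toCLM.le_opNorm y
    calc ‖ρ.t x * star (ρ.t (q.1.adj y))‖ ≤ ‖ρ.t x‖ * ‖star (ρ.t (q.1.adj y))‖ := norm_mul_le _ _
      _ ≤ ‖x‖ * (‖q.1‖ * ‖y‖) := by
        rw [norm_star]
        gcongr
        · exact ρ.norm_t_le x
        · exact (ρ.norm_t_le _).trans h1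
      _ = ‖x‖ * ‖y‖ * ‖q.1‖ := by ring
  | zero => exact ⟨0, le_rfl, fun q _ => by simp⟩
  | add p p' _ _ h h' =>
    obtain ⟨c, hc, h⟩ := h
    obtain ⟨c', hc', h'⟩ := h'
    refine ⟨c + c', by positivity, fun q hq => ?_⟩
    rw [add_mul, add_mul]
    exact (norm_add_le _ _).trans (add_le_add (h q hq) (h' q hq))
  | smul a p _ h =>
    obtain ⟨c, hc, h⟩ := h
    refine ⟨‖a‖ * c, by positivity, fun q hq => ?_⟩
    rw [smul_mul_assoc, mul_assoc]
    exact (norm_smul_le _ _).trans (mul_le_mul_of_nonneg_left (h q hq) (norm_nonneg _))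

/-- The crude constant `c` is removed by passing to high powers: by the `C*`-identity the norm of a
self-adjoint second component is exactly multiplicative under repeated squaring, while the first
component is submultiplicative, and `c` does not grow with the exponent. -/
lemma norm_le_of_isSelfAdjoint {p : Adjointable A E × 𝒳} (hp : p ∈ ρ.compactGraph)
    (hs : IsSelfAdjoint p.2) : ‖p.2‖ ≤ ‖p.1‖ := by
  obtain ⟨c, hc, hle⟩ := ρ.exists_norm_mul_le hp
  -- Here `q` is `p` to the power `2 ^ (k + 1) - 1`, so `p * q` is an iterated square. The extra
  -- factor `‖p.1‖` in the last bound avoids the subtraction in the exponent.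
  have key : ∀ k : ℕ, ∃ q ∈ ρ.compactGraph, IsSelfAdjoint (p * q).2 ∧
      ‖(p * q).2‖ = ‖p.2‖ ^ 2 ^ (k + 1) ∧ ‖p.1‖ * ‖q.1‖ ≤ ‖p.1‖ ^ 2 ^ (k + 1) := by
    intro k
    have hsq : ∀ a : 𝒳, IsSelfAdjoint a → IsSelfAdjoint (a * a) ∧ ‖a * a‖ = ‖a‖ ^ 2 :=
      fun a ha => ⟨by rw [IsSelfAdjoint, star_mul, ha.star_eq], by
        have := CStarRing.norm_star_mul_self (x := a)
        rwa [ha.star_eq, ← sq] at this⟩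
    induction k with
    | zero =>
      refine ⟨p, hp, (hsq _ hs).1, ?_, ?_⟩
      · simpa using (hsq _ hs).2
      · simp [sq]
    | succ k ih =>
      obtain ⟨q, hq, h1, h2, h3⟩ := ih
      refine ⟨q * (p * q), ρ.mul_mem_compactGraph hq (ρ.mul_mem_compactGraph hp hq), ?_, ?_, ?_⟩
      · rw [← mul_assoc]
        exact (hsq _ h1).1
      · rw [← mul_assoc, pow_succ 2 (k + 1), pow_mul, ← h2]
        exact (hsq _ h1).2
      · calc ‖p.1‖ * ‖q.1 * (p.1 * q.1)‖ ≤ ‖p.1‖ * (‖q.1‖ * (‖p.1‖ * ‖q.1‖)) := by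
              gcongr
              exact (norm_mul_le _ _).trans (by gcongr; exact norm_mul_le _ _)
          _ = (‖p.1‖ * ‖q.1‖) ^ 2 := by ring
          _ ≤ (‖p.1‖ ^ 2 ^ (k + 1)) ^ 2 := by gcongr
          _ = ‖p.1‖ ^ 2 ^ (k + 1 + 1) := by rw [pow_succ 2 (k + 1), pow_mul]
  by_contra! hlt
  have hb : 0 < ‖p.2‖ := (norm_nonneg _).trans_lt hlt
  have hlim : Tendsto (fun k : ℕ => c * (‖p.1‖ / ‖p.2‖) ^ 2 ^ (k + 1)) atTop (𝓝 (c * 0)) := by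
    refine Tendsto.const_mul c ?_
    refine (tendsto_pow_atTop_nhds_zero_of_lt_one (by positivity)
      ((div_lt_one hb).2 hlt)).comp ?_
    exact (tendsto_pow_atTop_atTop_of_one_lt one_lt_two).comp (tendsto_add_atTop_nat 1)
  have hge : ∀ k : ℕ, ‖p.1‖ ≤ c * (‖p.1‖ / ‖p.2‖) ^ 2 ^ (k + 1) := by
    intro k
    obtain ⟨q, hq, -, h2, h3⟩ := key k
    have h4 := hle q hq
    rw [h2] at h4
    rw [div_pow, ← mul_div_assoc, le_div_iff₀ (by positivity)]
    calc ‖p.1‖ * ‖p.2‖ ^ 2 ^ (k + 1) ≤ ‖p.1‖ * (c * ‖q.1‖) := by gcongr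
      _ = c * (‖p.1‖ * ‖q.1‖) := by ring
      _ ≤ c * ‖p.1‖ ^ 2 ^ (k + 1) := by gcongr
  -- If the inequality fails, the ratio of norms is below `1` and its powers tend to `0`, which
  -- forces `p.1 = 0`. Then the bound with `q = p` gives `p.2 ^ 2 = 0`, contrary to `0 < ‖p.2‖`.
  have h0 : ‖p.1‖ = 0 := by
    refine le_antisymm ?_ (norm_nonneg _)
    simpa using ge_of_tendsto' hlim hge
  have h1 := hle p hp
  rw [h0, mul_zero, Prod.snd_mul] at h1
  have h2 := CStarRing.norm_star_mul_self (x := p.2)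
  rw [hs.star_eq] at h2
  nlinarith

/-- The `C*`-identity on both components reduces this to the self-adjoint pair `p* p`. -/
lemma norm_le_of_mem_compactGraph {p : Adjointable A E × 𝒳} (hp : p ∈ ρ.compactGraph) :
    ‖p.2‖ ≤ ‖p.1‖ := by
  have h := ρ.norm_le_of_isSelfAdjoint (ρ.mul_mem_compactGraph (ρ.star_mem_compactGraph hp) hp)
    (IsSelfAdjoint.star_mul_self p.2)
  change ‖star p.2 * p.2‖ ≤ ‖star p.1 * p.1‖ at h
  rw [CStarRing.norm_star_mul_self, CStarRing.norm_star_mul_self] at h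
  exact abs_le_of_sq_le_sq' (by rwa [sq, sq]) (norm_nonneg _) |>.2

/-- The norm bound on the graph gives well-definedness on finite rank operators and extension to
their closure at once. Products stay in the family because `Θ_{x,y} T = Θ_{x,T* y}`. -/
lemma exists_compactRep : ∃ ψ : compacts A E →⋆ₙₐ[ℂ] 𝒳,
    (∀ x y : E, ψ ⟨Theta A x y, Theta_mem_compacts x y⟩ = ρ.t x * star (ρ.t y)) ∧
      ∀ T, ‖ψ T‖ ≤ ‖T‖ := by
  let a : E × E → compacts A E := fun q => ⟨Theta A q.1 q.2, Theta_mem_compacts q.1 q.2⟩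
  let b : E × E → 𝒳 := fun q => ρ.t q.1 * star (ρ.t q.2)
  have hd : ∀ T : compacts A E, T ∈ (Submodule.span ℂ (Set.range a)).topologicalClosure := by
    intro T
    refine closure_subtype.2 (closure_mono ?_ T.2)
    intro R hR
    change R ∈ Submodule.span ℂ {T | ∃ x y : E, T = Theta A x y} at hR
    induction hR using Submodule.span_induction with
    | mem R hR =>
      obtain ⟨x, y, rfl⟩ := hR
      exact ⟨a (x, y), Submodule.subset_span ⟨(x, y), rfl⟩, rfl⟩
    | zero => exact ⟨0, Submodule.zero_mem _, rfl⟩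
    | add R R' _ _ h h' =>
      obtain ⟨U, hU, rfl⟩ := h
      obtain ⟨U', hU', rfl⟩ := h'
      exact ⟨U + U', Submodule.add_mem _ hU hU', rfl⟩
    | smul c R _ h =>
      obtain ⟨U, hU, rfl⟩ := h
      exact ⟨c • U, Submodule.smul_mem _ c hU, rfl⟩
  have hn : ∀ c : E × E →₀ ℂ,
      ((Finsupp.linearCombination ℂ a c : Adjointable A E), Finsupp.linearCombination ℂ b c) ∈
        ρ.compactGraph := by
    intro c
    induction c using Finsupp.induction_linear with
    | zero =>
      rw [map_zero, map_zero]
      exact Submodule.zero_mem _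
    | add c c' h h' =>
      rw [map_add, map_add]
      exact Submodule.add_mem _ h h'
    | single q z =>
      rw [Finsupp.linearCombination_single, Finsupp.linearCombination_single]
      exact Submodule.smul_mem _ z (ρ.Theta_mem_compactGraph q.1 q.2)
  have : NormedStarGroup (compacts A E) := ⟨fun T => (norm_star (T : Adjointable A E)).le⟩
  obtain ⟨ψ, hψ, hle⟩ := exists_starHom_of_norm_le (a := a) (b := b) hd
    (fun c => ρ.norm_le_of_mem_compactGraph (hn c))
    (fun q r => by
      have h := ρ.Theta_mul_compactGraph (ρ.Theta_mem_compactGraph r.1 r.2) q.1 q.2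
      exact ⟨(q.1, (Theta A r.1 r.2).adj q.2), Subtype.ext (congrArg Prod.fst h),
        congrArg Prod.snd h⟩)
    (fun q => ⟨q.swap, rfl, by simp [b]⟩)
  exact ⟨ψ, fun x y => hψ (x, y), hle⟩

end ToeplitzRep
end Compacts

/-! ### Finitely additive maps on a Boolean algebra -/

section Additive

variable {B : Type u} [GeneralizedBooleanAlgebra B] {V : Type v} [AddCommGroup V] [Module ℂ V]
  {μ : B → V}

/-- By the prime ideal theorem some prime ideal avoids the principal filter of `A`; its complement
is the required ultrafilter. -/
lemma exists_mem_stoneDual {A : B} (hA : A ≠ ⊥) : ∃ ξ : StoneDual B, A ∈ ξ.carrier := by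
  have hd : Disjoint (Order.PFilter.principal A : Set B)
      (Order.Ideal.principal ⊥ : Order.Ideal B) := by
    rw [Set.disjoint_left]
    intro C hC hC'
    have h1 : A ≤ C := hC
    have h2 : C ≤ ⊥ := hC'
    exact hA (le_bot_iff.1 (h1.trans h2))
  obtain ⟨J, hJ, -, hJd⟩ := DistribLattice.prime_ideal_of_disjoint_filter_ideal hd
  rw [Set.disjoint_left] at hJd
  have hAJ : A ∉ J := hJd (show A ≤ A from le_rfl)
  exact ⟨{  carrier := {C | C ∉ J}
            nonempty := ⟨A, hAJ⟩
            bot_notMem := fun h => h J.bot_mem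
            mem_of_le := fun h hle h' => h (J.lower hle h')
            inf_mem := fun h h' hi => (hJ.mem_or_mem hi).elim h h'
            mem_or_mem := fun h => by
              by_contra! hc
              simp only [Set.mem_ofPred_eq, not_not] at hc
              exact h (Order.Ideal.sup_mem hc.1 hc.2) }, hAJ⟩

/-- Inclusion–exclusion for the disjoint decomposition of `A` by `U`. -/
lemma additive_sdiff_add_inf (hbot : μ ⊥ = 0)
    (hsup : ∀ A A', μ (A ⊔ A') = μ A + μ A' - μ (A ⊓ A')) (A U : B) :
    μ A = μ (A ⊓ U) + μ (A \ U) := by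
  have h := hsup (A ⊓ U) (A \ U)
  rwa [sup_inf_sdiff, inf_inf_sdiff, hbot, sub_zero] at h

lemma additive_inf_sup (hbot : μ ⊥ = 0) (hsup : ∀ A A', μ (A ⊔ A') = μ A + μ A' - μ (A ⊓ A'))
    {ι : Type*} {E : ι → B} (hE : Pairwise (Function.onFun Disjoint E)) (A : B) (s : Finset ι) :
    μ (A ⊓ s.sup E) = ∑ i ∈ s, μ (A ⊓ E i) := by
  classical
  induction s using Finset.induction_on with
  | empty => simp [hbot]
  | insert i s hi ih =>
    have hd : Disjoint (E i) (s.sup E) := by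
      rw [Finset.disjoint_sup_right]
      exact fun j hj => hE fun h => hi (h ▸ hj)
    have hb : A ⊓ E i ⊓ (A ⊓ s.sup E) = ⊥ :=
      (hd.mono inf_le_right inf_le_right).eq_bot
    rw [Finset.sup_insert, inf_sup_left, hsup, hb, hbot, sub_zero, ih, Finset.sum_insert hi]

/-- A linear combination of values of a finitely additive map can be taken over disjoint
elements. -/
lemma exists_disjoint_sum (hbot : μ ⊥ = 0)
    (hsup : ∀ A A', μ (A ⊔ A') = μ A + μ A' - μ (A ⊓ A')) (c : B →₀ ℂ) :
    ∃ (ι : Type) (_ : Fintype ι) (E : ι → B) (d : ι → ℂ),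
      Pairwise (Function.onFun Disjoint E) ∧
        Finsupp.linearCombination ℂ μ c = ∑ i, d i • μ (E i) := by
  induction c using Finsupp.induction with
  | zero => exact ⟨Empty, inferInstance, fun i => i.elim, fun i => i.elim, fun i => i.elim, by simp⟩
  | single_add A z c _ _ ih =>
    obtain ⟨ι, _, E, d, hE, hc⟩ := ih
    set U := Finset.univ.sup E
    have hU : ∀ i, E i ≤ U := fun i => Finset.le_sup (Finset.mem_univ i)
    -- Adding `z • μ A` refines the old disjoint family by `A`: the parts inside `A` get coefficient
    -- `z + d i`, the parts outside keep `d i`, and the remainder of `A` outside the union `U` gets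
    -- `z`.
    refine ⟨ι ⊕ ι ⊕ Unit, inferInstance,
      Sum.elim (fun i => A ⊓ E i) (Sum.elim (fun i => E i \ A) fun _ => A \ U),
      Sum.elim (fun i => z + d i) (Sum.elim d fun _ => z), ?_, ?_⟩
    · have h1 : ∀ i j, Disjoint (A ⊓ E i) (E j \ A) := fun i j =>
        disjoint_sdiff_self_right.mono_left inf_le_left
      have h2 : ∀ i, Disjoint (A ⊓ E i) (A \ U) := fun i =>
        disjoint_sdiff_self_right.mono_left (inf_le_right.trans (hU i))
      have h3 : ∀ i, Disjoint (E i \ A) (A \ U) := fun i =>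
        disjoint_sdiff_self_left.mono_right sdiff_le
      rintro (i | i | i) (j | j | j) hij
      · exact (hE fun h => hij (congrArg Sum.inl h)).mono inf_le_right inf_le_right
      · exact h1 i j
      · exact h2 i
      · exact (h1 j i).symm
      · exact (hE fun h => hij (congrArg (Sum.inr ∘ Sum.inl) h)).mono sdiff_le sdiff_le
      · exact h3 i
      · exact (h2 j).symm
      · exact (h3 j).symm
      · exact absurd rfl hij
    · have hA := additive_sdiff_add_inf hbot hsup A U
      rw [additive_inf_sup hbot hsup hE] at hA
      have hEi : ∀ i, μ (E i) = μ (A ⊓ E i) + μ (E i \ A) := fun i => by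
        rw [additive_sdiff_add_inf hbot hsup (E i) A, inf_comm]
      rw [map_add, Finsupp.linearCombination_single, hc, hA]
      simp only [Fintype.sum_sum_type, Sum.elim_inl, Sum.elim_inr, Finset.univ_unique,
        Finset.sum_singleton, hEi, smul_add, add_smul, Finset.sum_add_distrib, Finset.smul_sum]
      abel

end Additive

/-! ### Representations of the coefficient algebra -/

section CoeffHom

variable {B : Type u} [GeneralizedBooleanAlgebra B]

lemma chi_bot : chi (⊥ : B) = 0 := by
  refine Subtype.ext ?_
  ext ξ
  change chi₀ (⊥ : B) ξ = 0
  simp [chi₀_apply, Z_bot]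

lemma chi_sup (A A' : B) : chi (A ⊔ A') = chi A + chi A' - chi (A ⊓ A') := by
  refine Subtype.ext ?_
  ext ξ
  change chi₀ (A ⊔ A') ξ = chi₀ A ξ + chi₀ A' ξ - chi₀ (A ⊓ A') ξ
  simp only [chi₀_apply, Z_sup, Z_inf]
  by_cases h : ξ ∈ Z A <;> by_cases h' : ξ ∈ Z A' <;> simp [h, h']

/-- Some ultrafilter contains `A`, and there the indicator is `1`. This gives the lower bound for
the norm in the coefficient algebra used in `norm_sum_smul_le`. -/
lemma chi_ne_zero {A : B} (hA : A ≠ ⊥) : chi A ≠ 0 := by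
  intro h
  obtain ⟨ξ, hξ⟩ := exists_mem_stoneDual hA
  have h1 : chi₀ A ξ = 0 := by
    rw [show chi₀ A = 0 from congrArg Subtype.val h]
    rfl
  have h2 : ξ ∈ Z A := hξ
  simp [chi₀_apply, h2] at h1

/-- Since `χ_A χ_{A'} = χ_{A ⊓ A'}`, the closed span of all the `χ_A` is already closed under
products and adjoints: it is the closed ideal attached to the improper ideal `⊤`. -/
lemma mem_closure_span_chi (f : CoeffAlgebra B) :
    f ∈ (Submodule.span ℂ (Set.range (chi (B := B)))).topologicalClosure := by
  have h : f ∈ idealSpan (⊤ : Order.Ideal B) :=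
    coeff_induction (p := fun f => f ∈ idealSpan (⊤ : Order.Ideal B)) (isClosed_idealSpan _)
      (fun A => chi_mem_idealSpan (LowerSet.mem_top : A ∈ (⊤ : LowerSet B)))
      (Submodule.zero_mem _)
      (fun f g hf hg => Submodule.add_mem _ hf hg) (fun c f hf => Submodule.smul_mem _ c hf)
      (fun f g _ hg => mul_mem_idealSpan _ _ hg) (fun f hf => star_mem_idealSpan _ hf) f
  rwa [idealSpan, Order.Ideal.coe_top, Set.image_univ] at h

variable {𝒳 : Type w} [NonUnitalCStarAlgebra 𝒳]

/-- For orthogonal projections the square of the left side is the norm of `∑ |d i|² P (E i)`, which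
is dominated by `(max |d i|)²` times the projection of the union, the maximum being over nonempty `E
i`. That maximum is at most the right side. -/
lemma norm_sum_smul_le {ι : Type*} [Fintype ι] {E : ι → B}
    (hE : Pairwise (Function.onFun Disjoint E)) (d : ι → ℂ) {P : B → 𝒳}
    (hP : ∀ A, IsStarProjection (P A)) (hbot : P ⊥ = 0)
    (hinf : ∀ A A', P (A ⊓ A') = P A * P A')
    (hsup : ∀ A A', P (A ⊔ A') = P A + P A' - P (A ⊓ A')) :
    ‖∑ i, d i • P (E i)‖ ≤ ‖∑ i, d i • chi (E i)‖ := by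
  classical
  set f := ∑ i, d i • chi (E i) with hf
  have hE0 : ∀ i j, i ≠ j → E i ⊓ E j = ⊥ := fun i j hij => (hE hij).eq_bot
  -- Multiplication by `χ_{E i}` isolates the `i`-th term. Coefficients of empty `E i` are
  -- unconstrained, but there `P (E i) = 0`.
  have hd : ∀ i, E i ≠ ⊥ → ‖d i‖ ≤ ‖f‖ := by
    intro i hi
    have h1 : chi (E i) * f = d i • chi (E i) := by
      rw [hf, Finset.mul_sum, Finset.sum_eq_single i]
      · rw [mul_smul_comm, chi_mul, inf_idem]
      · intro j _ hj
        rw [mul_smul_comm, chi_mul, hE0 i j hj.symm, chi_bot, smul_zero]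
      · exact fun h => absurd (Finset.mem_univ i) h
    have h2 : 0 < ‖chi (E i)‖ := norm_pos_iff.2 (chi_ne_zero hi)
    have h3 := norm_mul_le (chi (E i)) f
    rw [h1, norm_smul, mul_comm] at h3
    exact le_of_mul_le_mul_left h3 h2
  let _ : PartialOrder 𝒳 := CStarAlgebra.spectralOrder 𝒳
  have _ : StarOrderedRing 𝒳 := CStarAlgebra.spectralOrderedRing 𝒳
  have hP0 : ∀ A, 0 ≤ P A := fun A => by
    have h := star_mul_self_nonneg (P A)
    rwa [(hP A).isSelfAdjoint.star_eq, (hP A).isIdempotentElem.eq] at h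
  have hx : star (∑ i, d i • P (E i)) * ∑ i, d i • P (E i) = ∑ i, (‖d i‖ ^ 2) • P (E i) := by
    rw [star_sum, Finset.sum_mul]
    refine Finset.sum_congr rfl fun i _ => ?_
    rw [Finset.mul_sum, Finset.sum_eq_single i]
    · rw [star_smul, smul_mul_smul_comm, (hP _).isSelfAdjoint.star_eq, ← hinf, inf_idem,
        ← Complex.coe_smul, Complex.star_def, Complex.conj_mul']
      simp
    · intro j _ hj
      rw [star_smul, smul_mul_smul_comm, (hP _).isSelfAdjoint.star_eq, ← hinf, hE0 i j hj.symm,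
        hbot, smul_zero]
    · exact fun h => absurd (Finset.mem_univ i) h
  have hle : ∑ i, (‖d i‖ ^ 2) • P (E i) ≤ (‖f‖ ^ 2) • P (Finset.univ.sup E) := by
    have h := additive_inf_sup hbot hsup hE (Finset.univ.sup E) Finset.univ
    rw [inf_idem] at h
    rw [h, Finset.smul_sum]
    refine Finset.sum_le_sum fun i _ => ?_
    rw [inf_eq_right.2 (Finset.le_sup (Finset.mem_univ i))]
    by_cases hi : E i = ⊥
    · rw [hi, hbot, smul_zero, smul_zero]
    · exact smul_le_smul_of_nonneg_right (pow_le_pow_left₀ (norm_nonneg _) (hd i hi) 2) (hP0 _)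
  refine abs_le_of_sq_le_sq' ?_ (norm_nonneg _) |>.2
  rw [sq ‖∑ i, d i • P (E i)‖, ← CStarRing.norm_star_mul_self]
  calc _ ≤ ‖(‖f‖ ^ 2) • P (Finset.univ.sup E)‖ :=
        CStarAlgebra.norm_le_norm_of_nonneg_of_le (star_mul_self_nonneg _) (hx.trans_le hle)
    _ ≤ ‖f‖ ^ 2 * 1 := by
        rw [norm_smul]
        simpa using mul_le_mul_of_nonneg_left ((hP _).norm_le)
          (sq_nonneg ‖f‖)
    _ = ‖f‖ ^ 2 := mul_one _

lemma exists_coeffHom {P : B → 𝒳} (hP : ∀ A, IsStarProjection (P A)) (hbot : P ⊥ = 0)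
    (hinf : ∀ A A', P (A ⊓ A') = P A * P A')
    (hsup : ∀ A A', P (A ⊔ A') = P A + P A' - P (A ⊓ A')) :
    ∃ π : CoeffAlgebra B →⋆ₙₐ[ℂ] 𝒳, ∀ A, π (chi A) = P A := by
  obtain ⟨π, hπ, -⟩ := exists_starHom_of_norm_le (a := chi) (b := P) mem_closure_span_chi
    (fun c => by
      -- The disjoint rewriting is applied to the pair-valued map, so that the same elements and
      -- coefficients serve for `χ` and for `P`.
      have h0 : (fun A : B => (chi A, P A)) ⊥ = 0 := Prod.ext chi_bot hbot
      obtain ⟨ι, _, E, d, hE, hc⟩ := exists_disjoint_sum (μ := fun A : B => (chi A, P A)) h0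
        (fun A A' => Prod.ext (chi_sup A A') (hsup A A')) c
      have h1 : Finsupp.linearCombination ℂ (chi (B := B)) c = ∑ i, d i • chi (E i) := by
        have h := congrArg (LinearMap.fst ℂ (CoeffAlgebra B) 𝒳) hc
        rw [Finsupp.apply_linearCombination, map_sum] at h
        exact h
      have h2 : Finsupp.linearCombination ℂ P c = ∑ i, d i • P (E i) := by
        have h := congrArg (LinearMap.snd ℂ (CoeffAlgebra B) 𝒳) hc
        rw [Finsupp.apply_linearCombination, map_sum] at h
        exact h
      rw [h1, h2]
      exact norm_sum_smul_le hE d hP hbot hinf hsup)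
    (fun A A' => ⟨A ⊓ A', chi_mul A A', (hinf A A').symm⟩)
    (fun A => ⟨A, star_chi A, (hP A).isSelfAdjoint.star_eq⟩)
  exact ⟨π, hπ⟩

lemma coeffHom_ext {π π' : CoeffAlgebra B →⋆ₙₐ[ℂ] 𝒳} (h : ∀ A, π (chi A) = π' (chi A)) :
    π = π' := by
  have hc : ∀ σ : CoeffAlgebra B →⋆ₙₐ[ℂ] 𝒳, Continuous σ := fun σ => by
    open scoped CStarAlgebra in exact map_continuous σ
  ext f
  refine dense_span_induction mem_closure_span_chi (p := fun f => π f = π' f)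
    (isClosed_eq (hc π) (hc π')) h ?_ ?_ ?_ f
  · rw [map_zero, map_zero]
  · intro f g hf hg
    rw [map_add, map_add, hf, hg]
  · intro c f hf
    rw [map_smul, map_smul, hf]

end CoeffHom

/-! ### The correspondence `X(B, L, θ, I_α)` -/

namespace GeneralizedBooleanDynamicalSystem

variable {B : Type u} {L : Type v} [GeneralizedBooleanAlgebra B]
  (S : GeneralizedBooleanDynamicalSystem B L)

lemma coord_e_self (α : L) (C : S.I α) : (S.e α C).coord α = chi (C : B) :=
  by classical exact Pi.single_eq_same (M := fun _ => CoeffAlgebra B) α _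

lemma coord_e_of_ne {α β : L} (h : β ≠ α) (C : S.I α) : (S.e α C).coord β = 0 :=
  by classical exact Pi.single_eq_of_ne (M := fun _ => CoeffAlgebra B) h _

lemma inner_e_left (α : L) (C : S.I α) (x : S.X) :
    ⟪S.e α C, x⟫_(CoeffAlgebra B) = chi (C : B) * x.coord α := by
  rw [X.inner_def, tsum_eq_single α, coord_e_self, star_chi]
  intro β hβ
  rw [coord_e_of_ne S hβ, star_zero, zero_mul]

lemma inner_e_e (α : L) (C C' : S.I α) :
    ⟪S.e α C, S.e α C'⟫_(CoeffAlgebra B) = chi ((C : B) ⊓ C') := by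
  rw [inner_e_left, coord_e_self, chi_mul]

lemma inner_e_e_of_ne {α α' : L} (h : α ≠ α') (C : S.I α) (C' : S.I α') :
    ⟪S.e α C, S.e α' C'⟫_(CoeffAlgebra B) = 0 := by
  rw [inner_e_left, coord_e_of_ne S h, mul_zero]

/-- With right linearity of `t` this shows that `t(e_{α,C})` is a partial isometry. -/
lemma chi_smul_e (α : L) (C : S.I α) : chi (C : B) • S.e α C = S.e α C := by
  ext β
  rw [X.coord_coeff_smul]
  by_cases h : β = α
  · subst h
    rw [coord_e_self, chi_mul, inf_idem]
  · rw [coord_e_of_ne S h, zero_mul]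

/-- The left action of `χ_A` on `e_{α,C}` is a right action, by commutativity of the coefficient
algebra; applying `t` gives relation (ii). -/
lemma φ_chi_e (A : B) (α : L) (C : S.I α) :
    (S.φ (chi A)).toCLM (S.e α C) = chi (S.θ α A) • S.e α C := by
  ext β
  rw [φ_apply_coord, X.coord_coeff_smul, φc_chi]
  by_cases h : β = α
  · subst h
    rw [mul_comm]
  · rw [coord_e_of_ne S h, zero_mul, mul_zero]

lemma norm_φ_le (f : CoeffAlgebra B) : ‖S.φ f‖ ≤ ‖f‖ :=
  (S.φLin f).mkContinuous_norm_le (norm_nonneg f) (S.norm_φLin_le f)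

variable {S} in
lemma X.coord_sum {ι : Type*} (s : Finset ι) (x : ι → S.X) (α : L) :
    (∑ i ∈ s, x i).coord α = ∑ i ∈ s, (x i).coord α :=
  map_sum (⟨⟨fun x : S.X => x.coord α, X.coord_zero α⟩, fun x y => X.coord_add x y α⟩ :
    S.X →+ CoeffAlgebra B) x s

/-- The operator `φ(χ_A)` multiplies the coordinate `α` by `χ_{θ_α(A)}`, and so does the `α`-th rank
one operator, which kills all other coordinates. Outside `Δ_A` the multiplier is `χ_∅ = 0`, so
finitely many coordinates matter. -/
lemma φ_chi_eq_sum (A : B) (hA : (S.Δ A).Finite) :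
    S.φ (chi A) = ∑ α ∈ hA.toFinset,
      Theta (CoeffAlgebra B) (S.e α (S.θI α A)) (S.e α (S.θI α A)) := by
  ext x β
  have h : (∑ α ∈ hA.toFinset,
      Theta (CoeffAlgebra B) (S.e α (S.θI α A)) (S.e α (S.θI α A))).toCLM x =
      ∑ α ∈ hA.toFinset, (chi (S.θ α A) * x.coord α) • S.e α (S.θI α A) := by
    have h1 := map_sum (Adjointable.toCLMHom (A := CoeffAlgebra B) (E := S.X))
      (fun α => Theta (CoeffAlgebra B) (S.e α (S.θI α A)) (S.e α (S.θI α A))) hA.toFinset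
    refine (congrArg (fun T : S.X →L[ℂ] S.X => T x) h1).trans ?_
    rw [sum_apply]
    refine Finset.sum_congr rfl fun α _ => ?_
    exact congrArg (· • S.e α (S.θI α A)) (S.inner_e_left α (S.θI α A) x)
  rw [h, X.coord_sum, φ_apply_coord, φc_chi]
  by_cases hβ : β ∈ S.Δ A
  · rw [Finset.sum_eq_single β]
    · rw [X.coord_coeff_smul, coord_e_self, ← mul_assoc]
      change _ = chi (S.θ β A) * chi (S.θ β A) * _
      rw [chi_mul, inf_idem]
    · intro α _ hα
      rw [X.coord_coeff_smul, coord_e_of_ne S hα.symm, zero_mul]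
    · exact fun h => absurd (hA.mem_toFinset.2 hβ) h
  · rw [Finset.sum_eq_zero]
    · have h0 : S.θ β A = ⊥ := not_not.1 hβ
      rw [h0, chi_bot, zero_mul]
    · intro α hα
      rw [X.coord_coeff_smul, coord_e_of_ne S, zero_mul]
      rintro rfl
      exact hβ (hA.mem_toFinset.1 hα)

/-! ### Density of the span of the vectors `e_{α,C}`. -/

/-- The inclusion of `X_α` into `X`. -/
def single (α : L) : S.Xc α →ₗ[ℂ] S.X := by
  classical
  exact
    { toFun f := ⟨Pi.single α (f : CoeffAlgebra B), fun β => by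
          by_cases h : β = α
          · subst h
            rw [Pi.single_eq_same]
            exact f.2
          · rw [Pi.single_eq_of_ne h]
            exact Submodule.zero_mem _,
        summable_of_ne_finset_zero (s := {α}) fun β hβ => by
          rw [Pi.single_eq_of_ne (by simpa using hβ), mul_zero]⟩
      map_add' f g := Subtype.ext (Pi.single_add (f := fun _ => CoeffAlgebra B) α _ _)
      map_smul' c f := Subtype.ext (Pi.single_smul (f := fun _ => CoeffAlgebra B) α c _) }

lemma coord_single_self (α : L) (f : S.Xc α) : (S.single α f).coord α = f :=
  by classical exact Pi.single_eq_same (M := fun _ => CoeffAlgebra B) α _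

lemma coord_single_of_ne {α β : L} (h : β ≠ α) (f : S.Xc α) : (S.single α f).coord β = 0 :=
  by classical exact Pi.single_eq_of_ne (M := fun _ => CoeffAlgebra B) h _

/-- Isometry lets approximations in `X_α` by combinations of the `χ_C` be carried into `X`. -/
lemma norm_single (α : L) (f : S.Xc α) : ‖S.single α f‖ = ‖f‖ := by
  have h : ⟪S.single α f, S.single α f⟫_(CoeffAlgebra B) = star (f : CoeffAlgebra B) * f := by
    rw [X.inner_def, tsum_eq_single α, coord_single_self]
    intro β hβ
    rw [coord_single_of_ne S hβ, mul_zero]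
  rw [CStarModule.norm_eq_sqrt_norm_inner_self (A := CoeffAlgebra B), h,
    CStarRing.norm_star_mul_self]
  exact Real.sqrt_mul_self (norm_nonneg _)

/-- The vector `e_{α,C}`, for the pair `⟨α, C⟩`. -/
def eFamily (q : Σ α, S.I α) : S.X := S.e q.1 q.2

lemma single_mem_closure_span_e (α : L) (f : S.Xc α) :
    S.single α f ∈ (Submodule.span ℂ (Set.range S.eFamily)).topologicalClosure := by
  have hspan : ∀ g ∈ Submodule.span ℂ (chi '' (S.I α : Set B)), ∃ hg : g ∈ S.Xc α,
      S.single α ⟨g, hg⟩ ∈ Submodule.span ℂ (Set.range S.eFamily) := by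
    intro g hg
    induction hg using Submodule.span_induction with
    | mem g hg =>
      obtain ⟨C, hC, rfl⟩ := hg
      exact ⟨chi_mem_idealSpan hC, Submodule.subset_span ⟨⟨α, C, hC⟩, rfl⟩⟩
    | zero => exact ⟨Submodule.zero_mem _, by
        rw [show (⟨0, Submodule.zero_mem _⟩ : S.Xc α) = 0 from rfl, map_zero]
        exact Submodule.zero_mem _⟩
    | add g g' _ _ h h' =>
      obtain ⟨hg, h⟩ := h
      obtain ⟨hg', h'⟩ := h'
      refine ⟨Submodule.add_mem _ hg hg', ?_⟩
      rw [show (⟨g + g', Submodule.add_mem _ hg hg'⟩ : S.Xc α) = ⟨g, hg⟩ + ⟨g', hg'⟩ from rfl,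
        map_add]
      exact Submodule.add_mem _ h h'
    | smul c g _ h =>
      obtain ⟨hg, h⟩ := h
      refine ⟨Submodule.smul_mem _ c hg, ?_⟩
      rw [show (⟨c • g, Submodule.smul_mem _ c hg⟩ : S.Xc α) = c • ⟨g, hg⟩ from rfl, map_smul]
      exact Submodule.smul_mem _ c h
  refine Metric.mem_closure_iff.2 fun ε hε => ?_
  obtain ⟨g, hg, hd⟩ := Metric.mem_closure_iff.1 f.2 ε hε
  obtain ⟨hg', hs⟩ := hspan g hg
  refine ⟨_, hs, ?_⟩
  rw [dist_eq_norm, ← map_sub, norm_single]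
  rwa [dist_eq_norm] at hd

/-- The squared distance from `x` to its truncation to a finite set of coordinates is the norm of a
tail of `∑ x_α* x_α`, which tends to `0`. Each truncation is a finite sum of vectors supported on
one coordinate. -/
lemma mem_closure_span_e (x : S.X) :
    x ∈ (Submodule.span ℂ (Set.range S.eFamily)).topologicalClosure := by
  classical
  let y : Finset L → S.X := fun s => ∑ α ∈ s, S.single α ⟨x.coord α, x.2.1 α⟩
  have hy : ∀ s, y s ∈ (Submodule.span ℂ (Set.range S.eFamily)).topologicalClosure :=
    fun s => Submodule.sum_mem _ fun α _ => S.single_mem_closure_span_e α _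
  have hcoord : ∀ s β, (x + (-1 : ℂ) • y s).coord β = if β ∈ s then 0 else x.coord β := by
    intro s β
    rw [X.coord_add, X.coord_smul, X.coord_sum]
    split_ifs with hβ
    · rw [Finset.sum_eq_single_of_mem β hβ fun α _ hα => coord_single_of_ne S hα.symm _,
        coord_single_self, neg_one_smul, add_neg_cancel]
    · rw [Finset.sum_eq_zero, smul_zero, add_zero]
      intro α hα
      exact coord_single_of_ne S (by rintro rfl; exact hβ hα) _
  have hinner : ∀ s, ⟪x + (-1 : ℂ) • y s, x + (-1 : ℂ) • y s⟫_(CoeffAlgebra B) =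
      ⟪x, x⟫_(CoeffAlgebra B) - ∑ α ∈ s, star (x.coord α) * x.coord α := by
    intro s
    -- The partial sum is written as a sum over all of `L`, so that it can be subtracted from `⟨x,
    -- x⟩` termwise.
    have h1 := hasSum_sum_of_ne_finset_zero (L := .unconditional L) (s := s)
      (f := fun β => if β ∈ s then star (x.coord β) * x.coord β else 0)
      (fun β hβ => if_neg hβ)
    rw [Finset.sum_congr rfl fun β hβ => if_pos hβ] at h1
    rw [X.inner_def S x x, ← ((X.summable x x).hasSum.sub h1).tsum_eq, X.inner_def]
    refine tsum_congr fun β => ?_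
    rw [hcoord]
    split_ifs <;> simp
  have hlim : Tendsto (fun s => ‖⟪x + (-1 : ℂ) • y s, x + (-1 : ℂ) • y s⟫_(CoeffAlgebra B)‖)
      atTop (𝓝 0) := by
    simp only [hinner]
    have h := (tendsto_const_nhds (x := ⟪x, x⟫_(CoeffAlgebra B))).sub (X.summable x x).hasSum
    rw [← X.inner_def, sub_self] at h
    simpa using h.norm
  refine (Submodule.isClosed_topologicalClosure _).mem_of_tendsto (b := atTop) (f := y) ?_
    (Eventually.of_forall hy)
  rw [tendsto_iff_norm_sub_tendsto_zero]
  have h2 := hlim.sqrt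
  rw [Real.sqrt_zero] at h2
  refine h2.congr fun s => ?_
  rw [← CStarModule.norm_eq_sqrt_norm_inner_self (A := CoeffAlgebra B) (E := S.X),
    neg_one_smul, ← sub_eq_add_neg, norm_sub_rev]

end GeneralizedBooleanDynamicalSystem

/-! ### The correspondence between representations -/

section Bijection

variable {B : Type u} {L : Type v} [GeneralizedBooleanAlgebra B]
  {𝒳 : Type w} [NonUnitalCStarAlgebra 𝒳]

lemma ToeplitzRep.ext_generators {S : GeneralizedBooleanDynamicalSystem B L}
    {ρ σ : ToeplitzRep S.φ 𝒳} (hπ : ∀ A, ρ.π (chi A) = σ.π (chi A))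
    (ht : ∀ α C, ρ.t (S.e α C) = σ.t (S.e α C)) : ρ = σ := by
  refine ToeplitzRep.ext (coeffHom_ext hπ) (LinearMap.ext fun x => ?_)
  refine dense_span_induction S.mem_closure_span_e (p := fun x => ρ.t x = σ.t x)
    (isClosed_eq ρ.continuous_t σ.continuous_t) (fun q => ht q.1 q.2) ?_ ?_ ?_ x
  · rw [map_zero, map_zero]
  · intro x y hx hy
    rw [map_add, map_add, hx, hy]
  · intro c x hx
    rw [map_smul, map_smul, hx]

namespace RelativeBooleanDynamicalSystem

variable (S : RelativeBooleanDynamicalSystem B L)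

/-- Regularity speaks only of nonempty elements, so `⊥` is treated separately: there `Δ` is empty.
-/
lemma finite_Δ {A : B} (hA : A ∈ S.J) : (S.Δ A).Finite := by
  by_cases h : A = ⊥
  · have h0 : S.Δ A = ∅ := by
      ext α
      simpa [BooleanDynamicalSystem.Δ, BooleanDynamicalSystem.θ, h] using (S.action α).map_bot
    rw [h0]
    exact Set.finite_empty
  · exact (S.isRegular_of_mem_J A hA A le_rfl h).2

lemma φ_chi_mem_compacts {A : B} (hA : (S.Δ A).Finite) :
    S.φ (chi A) ∈ compacts (CoeffAlgebra B) S.X := by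
  rw [S.φ_chi_eq_sum A hA]
  exact sum_mem fun α _ => Theta_mem_compacts _ _

/-- The right side of relation (iv) is the value of `ψ` at `φ(χ_A)`. Only the values of `ψ` on the
`Θ_{x,y}` enter, so this serves both for the `ψ` given with a coisometric representation and for the
one constructed in `exists_compactRep`. -/
lemma map_φ_chi {t : S.X → 𝒳} {ψ : compacts (CoeffAlgebra B) S.X →⋆ₙₐ[ℂ] 𝒳}
    (hψ : ∀ x y : S.X, ψ ⟨Theta (CoeffAlgebra B) x y, Theta_mem_compacts x y⟩ = t x * star (t y))
    {A : B} (hA : (S.Δ A).Finite) :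
    ψ ⟨S.φ (chi A), S.φ_chi_mem_compacts hA⟩ =
      ∑ᶠ α ∈ S.Δ A, t (S.e α (S.θI α A)) * star (t (S.e α (S.θI α A))) := by
  rw [finsum_mem_eq_finite_toFinset_sum _ hA, ← Finset.sum_congr rfl fun α _ => hψ _ _, ← map_sum]
  congr 1
  refine Subtype.ext ?_
  rw [AddSubmonoidClass.coe_finsetSum]
  exact S.φ_chi_eq_sum A hA

lemma isRepresentation_of_isCoisometric {ρ : ToeplitzRep S.φ 𝒳} (hρ : ρ.IsCoisometric S.K) :
    S.IsRepresentation (fun A => ρ.π (chi A)) fun α C => ρ.t (S.e α C) where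
  isStarProjection A :=
    { isIdempotentElem := by
        rw [IsIdempotentElem, ← map_mul, chi_mul, inf_idem]
      isSelfAdjoint := by
        rw [IsSelfAdjoint, ← map_star, star_chi] }
  isPartialIsometry α C := by
    rw [mul_assoc, ρ.star_t_mul_t, S.inner_e_e, inf_idem, ← ρ.t_smul, S.chi_smul_e]
  map_bot := by rw [chi_bot, map_zero]
  map_inf A A' := by rw [← chi_mul, map_mul]
  map_sup A A' := by rw [chi_sup, map_sub, map_add]
  P_mul_s A α C := by rw [ρ.π_mul_t, S.φ_chi_e, ρ.t_smul]
  star_s_mul_s α C C' := by rw [ρ.star_t_mul_t, S.inner_e_e]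
  star_s_mul_s_of_ne α α' C C' h := by rw [ρ.star_t_mul_t, S.inner_e_e_of_ne h, map_zero]
  P_eq_sum A hA := by
    obtain ⟨ψ, hψ, hK⟩ := hρ
    obtain ⟨hf, h⟩ := hK (chi A) (chi_mem_idealSpan hA)
    rw [h]
    exact S.map_φ_chi hψ (S.finite_Δ hA)

variable {S}

/-- Relation (i) produces `π`, relation (iii) prescribes the inner products and so produces `t`, and
relation (ii) is compatibility with the left action on generators, extended by density in both
variables. Relation (iv) plays no part here. -/
lemma IsRepresentation.exists_toeplitzRep {P : B → 𝒳} {s : ∀ α : L, S.I α → 𝒳}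
    (h : S.IsRepresentation P s) : ∃ ρ : ToeplitzRep S.φ 𝒳,
      (∀ A, ρ.π (chi A) = P A) ∧ ∀ α C, ρ.t (S.e α C) = s α C := by
  obtain ⟨π, hπ⟩ := exists_coeffHom h.isStarProjection h.map_bot h.map_inf h.map_sup
  have hπc : Continuous π := by
    open scoped CStarAlgebra in exact map_continuous π
  let b : (Σ α, S.I α) → 𝒳 := fun q => s q.1 q.2
  have hb : ∀ q r, star (b q) * b r = π ⟪S.eFamily q, S.eFamily r⟫_(CoeffAlgebra B) := by
    rintro ⟨α, C⟩ ⟨α', C'⟩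
    by_cases hα : α = α'
    · subst hα
      exact (h.star_s_mul_s α C C').trans ((congrArg π (S.inner_e_e α C C')).trans (hπ _)).symm
    · exact (h.star_s_mul_s_of_ne α α' C C' hα).trans
        ((congrArg π (S.inner_e_e_of_ne hα C C')).trans (map_zero π)).symm
  obtain ⟨t, ht, hinner⟩ := exists_clm_of_star_mul S.mem_closure_span_e hb
  have hd := S.mem_closure_span_e
  have hφ : ∀ (f : CoeffAlgebra B) (x : S.X), π f * t x = t ((S.φ f).toCLM x) := by
    intro f x
    refine dense_span_induction hd (p := fun x => π f * t x = t ((S.φ f).toCLM x))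
      ?_ ?_ ?_ ?_ ?_ x
    · exact isClosed_eq (by fun_prop) (by fun_prop)
    · intro q
      refine dense_span_induction mem_closure_span_chi
        (p := fun f => π f * t (S.eFamily q) = t ((S.φ f).toCLM (S.eFamily q))) ?_ ?_ ?_ ?_ ?_ f
      -- Continuity of `f ↦ φ(f) e_{α,C}` comes from `‖φ(f)‖ ≤ ‖f‖`.
      · refine isClosed_eq (by fun_prop) (t.continuous.comp ?_)
        refine (AddMonoidHomClass.continuous_of_bound
          (⟨⟨fun f => (S.φ f).toCLM (S.eFamily q), ?_⟩, ?_⟩ : CoeffAlgebra B →+ S.X)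
          ‖S.eFamily q‖ fun f => ?_ :)
        · exact congrArg (fun T => Adjointable.toCLM T (S.eFamily q)) (map_zero S.φ)
        · exact fun f g => congrArg (fun T => Adjointable.toCLM T (S.eFamily q)) (map_add S.φ f g)
        · rw [mul_comm]
          exact ((S.φ f).toCLM.le_opNorm _).trans
            (mul_le_mul_of_nonneg_right (S.norm_φ_le f) (norm_nonneg _))
      · intro A
        have h1 : (S.φ (chi A)).toCLM (S.eFamily q) = chi (S.θ q.1 A) • S.eFamily q :=
          S.φ_chi_e A q.1 q.2
        rw [hπ, ht, h1, map_smul_of_star_mul hinner, ht, hπ]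
        exact h.P_mul_s A q.1 q.2
      · rw [map_zero, zero_mul, map_zero]
        exact (map_zero t).symm
      · intro f g hf hg
        rw [map_add, add_mul, hf, hg]
        exact (map_add t _ _).symm.trans
          (congrArg (fun T => t (Adjointable.toCLM T (S.eFamily q))) (map_add S.φ f g).symm)
      · intro c f hf
        rw [map_smul, smul_mul_assoc, hf]
        exact (map_smul t _ _).symm.trans
          (congrArg (fun T => t (Adjointable.toCLM T (S.eFamily q))) (map_smul S.φ c f).symm)
    · simp
    · intro y y' hy hy'
      rw [map_add, mul_add, hy, hy', map_add, map_add]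
    · intro c y hy
      rw [map_smul, mul_smul_comm, hy, map_smul, map_smul]
  exact ⟨⟨π, t, hinner, hφ⟩, hπ, fun α C => ht ⟨α, C⟩⟩

/-- Relation (iv) is coisometry at `χ_A` for `A ∈ J`. It extends linearly to the span, and to `K_J`
because `π`, `φ` and `ψ` are continuous and the compact operators are closed. -/
lemma IsRepresentation.isCoisometric {ρ : ToeplitzRep S.φ 𝒳}
    (h : S.IsRepresentation (fun A => ρ.π (chi A)) fun α C => ρ.t (S.e α C)) :
    ρ.IsCoisometric S.K := by
  obtain ⟨ψ, hψ, hle⟩ := ρ.exists_compactRep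
  have hπc : Continuous ρ.π := by
    open scoped CStarAlgebra in exact map_continuous ρ.π
  have hφc : Continuous S.φ := AddMonoidHomClass.continuous_of_bound S.φ 1 fun f => by
    rw [one_mul]
    exact S.norm_φ_le f
  have hψc : Continuous ψ := AddMonoidHomClass.continuous_of_bound ψ 1 fun f => by
    rw [one_mul]
    exact hle f
  have hspan : ∀ f ∈ Submodule.span ℂ (chi '' (S.J : Set B)),
      ∃ hf : S.φ f ∈ compacts (CoeffAlgebra B) S.X, ρ.π f = ψ ⟨S.φ f, hf⟩ := by
    intro f hf
    induction hf using Submodule.span_induction with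
    | mem f hf =>
      obtain ⟨A, hA, rfl⟩ := hf
      exact ⟨S.φ_chi_mem_compacts (S.finite_Δ hA),
        (h.P_eq_sum A hA).trans (S.map_φ_chi hψ (S.finite_Δ hA)).symm⟩
    | zero =>
      have h0 := map_zero S.φ
      refine ⟨h0 ▸ zero_mem _, ?_⟩
      rw [map_zero, ← map_zero ψ]
      exact congrArg ψ (Subtype.ext h0.symm)
    | add f g _ _ hf hg =>
      obtain ⟨hf, h1⟩ := hf
      obtain ⟨hg, h2⟩ := hg
      have h0 := map_add S.φ f g
      refine ⟨h0 ▸ add_mem hf hg, ?_⟩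
      rw [map_add, h1, h2, ← map_add ψ]
      exact congrArg ψ (Subtype.ext h0.symm)
    | smul c f _ hf =>
      obtain ⟨hf, h1⟩ := hf
      have h0 := map_smul S.φ c f
      refine ⟨h0 ▸ SMulMemClass.smul_mem c hf, ?_⟩
      rw [map_smul, h1, ← map_smul ψ]
      exact congrArg ψ (Subtype.ext h0.symm)
  refine ⟨ψ, hψ, fun f hf => ?_⟩
  obtain ⟨u, hu, hlim⟩ := mem_closure_iff_seq_limit.1 hf
  choose hφu hψu using fun n => hspan (u n) (hu n)
  have hlim' : Tendsto (fun n => S.φ (u n)) atTop (𝓝 (S.φ f)) := (hφc.tendsto f).comp hlim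
  have hmem : S.φ f ∈ compacts (CoeffAlgebra B) S.X :=
    (NonUnitalStarSubalgebra.isClosed_topologicalClosure _).mem_of_tendsto hlim'
      (Eventually.of_forall hφu)
  refine ⟨hmem, tendsto_nhds_unique ((hπc.tendsto f).comp hlim) ?_⟩
  have h1 : Tendsto (fun n => (⟨S.φ (u n), hφu n⟩ : compacts (CoeffAlgebra B) S.X)) atTop
      (𝓝 ⟨S.φ f, hmem⟩) := tendsto_subtype_rng.2 hlim'
  exact ((hψc.tendsto _).comp h1).congr fun n => (hψu n).symm

variable (S) in
/-- Representations of `X` on `𝒳` correspond to representations of the dynamical system. -/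
theorem bijOn_isCoisometric :
    Set.BijOn
      (fun ρ : ToeplitzRep S.φ 𝒳 =>
        ((fun A => ρ.π (chi A), fun α C => ρ.t (S.e α C)) : (B → 𝒳) × (∀ α : L, S.I α → 𝒳)))
      {ρ | ρ.IsCoisometric S.K} {F | S.IsRepresentation F.1 F.2} := by
  refine ⟨fun ρ hρ => S.isRepresentation_of_isCoisometric hρ, fun ρ _ σ _ h => ?_, ?_⟩
  · exact ToeplitzRep.ext_generators (fun A => congrFun (congrArg Prod.fst h) A)
      fun α C => congrFun (congrFun (congrArg Prod.snd h) α) C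
  · rintro ⟨P, s⟩ hF
    obtain ⟨ρ, hπ, ht⟩ := IsRepresentation.exists_toeplitzRep hF
    obtain rfl : (fun A => ρ.π (chi A)) = P := funext hπ
    obtain rfl : (fun α C => ρ.t (S.e α C)) = s := funext fun α => funext (ht α)
    exact ⟨ρ, IsRepresentation.isCoisometric hF, rfl⟩

end RelativeBooleanDynamicalSystem

end Bijection

/-! ### Universal `C*`-algebras of generators and relations -/

section Universal

/-- The value of a `*`-monomial in the generators. -/
def evalWord {G : Type u} {C : Type v} [Semigroup C] [Star C] (f : G → C) :
    FreeSemigroup (G × Bool) →ₙ* C :=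
  FreeSemigroup.lift fun x => if x.2 then star (f x.1) else f x.1

lemma evalWord_of {G : Type u} {C : Type v} [Semigroup C] [Star C] (f : G → C) (x : G × Bool) :
    evalWord f (FreeSemigroup.of x) = if x.2 then star (f x.1) else f x.1 :=
  FreeSemigroup.lift_of _ _

/-- Reversing a word and toggling its stars gives the adjoint word. It depends on the word alone, so
one `y` works for both `f` and `h`. -/
lemma exists_star_evalWord {G : Type u} {C : Type v} {D : Type w} [Semigroup C] [StarMul C]
    [Semigroup D] [StarMul D] (f : G → C) (h : G → D) (x : FreeSemigroup (G × Bool)) :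
    ∃ y, star (evalWord f x) = evalWord f y ∧ star (evalWord h x) = evalWord h y := by
  induction x using FreeSemigroup.recOnMul with
  | ih1 x =>
    refine ⟨FreeSemigroup.of (x.1, !x.2), ?_⟩
    simp only [evalWord_of]
    cases x.2 <;> simp
  | ih2 x y hx hy =>
    obtain ⟨x', hx, hx'⟩ := hx
    obtain ⟨y', hy, hy'⟩ := hy
    refine ⟨y' * x', ?_⟩
    simp only [map_mul, star_mul, hx, hx', hy, hy', true_and]

variable {G : Type u} {C : Type v} {D : Type w} [NonUnitalCStarAlgebra C] [NonUnitalCStarAlgebra D]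

lemma map_evalWord (Φ : C →⋆ₙₐ[ℂ] D) (f : G → C) (x : FreeSemigroup (G × Bool)) :
    Φ (evalWord f x) = evalWord (fun g => Φ (f g)) x := by
  induction x using FreeSemigroup.recOnMul with
  | ih1 x =>
    simp only [evalWord_of]
    split_ifs
    · exact map_star Φ _
    · rfl
  | ih2 x y hx hy => rw [map_mul, map_mul, map_mul, hx, hy]

/-- The span of the `*`-monomials is closed under products and adjoints, hence contains the
`*`-algebra generated by `f`. Nonempty words suffice since no unit is adjoined. -/
lemma mem_closure_span_evalWord {f : G → C}
    (hf : (NonUnitalStarAlgebra.adjoin ℂ (Set.range f)).topologicalClosure = ⊤) (x : C) :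
    x ∈ (Submodule.span ℂ (Set.range (evalWord f))).topologicalClosure := by
  have hx : x ∈ (NonUnitalStarAlgebra.adjoin ℂ (Set.range f)).topologicalClosure := by
    rw [hf]
    trivial
  refine closure_mono ?_ hx
  intro y hy
  change y ∈ Submodule.span ℂ (Set.range (evalWord f))
  induction hy using NonUnitalStarAlgebra.adjoin_induction with
  | mem y hy =>
    obtain ⟨g, rfl⟩ := hy
    exact Submodule.subset_span ⟨FreeSemigroup.of (g, false), by simp [evalWord_of]⟩
  | add y z _ _ hy hz => exact Submodule.add_mem _ hy hz
  | zero => exact Submodule.zero_mem _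
  | mul y z hy' hz' hy hz =>
    clear hy' hz'
    induction hy, hz using Submodule.span_induction₂ with
    | mem_mem y z hy hz =>
      obtain ⟨a, rfl⟩ := hy
      obtain ⟨b, rfl⟩ := hz
      exact Submodule.subset_span ⟨a * b, map_mul _ _ _⟩
    | zero_left z _ => rw [zero_mul]; exact Submodule.zero_mem _
    | zero_right y _ => rw [mul_zero]; exact Submodule.zero_mem _
    | add_left x y z _ _ _ h h' => rw [add_mul]; exact Submodule.add_mem _ h h'
    | add_right x y z _ _ _ h h' => rw [mul_add]; exact Submodule.add_mem _ h h'
    | smul_left c x y _ _ h => rw [smul_mul_assoc]; exact Submodule.smul_mem _ c h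
    | smul_right c x y _ _ h => rw [mul_smul_comm]; exact Submodule.smul_mem _ c h
  | smul c y _ hy => exact Submodule.smul_mem _ c hy
  | star y hy' hy =>
    clear hy'
    induction hy using Submodule.span_induction with
    | mem y hy =>
      obtain ⟨a, rfl⟩ := hy
      obtain ⟨b, hb, -⟩ := exists_star_evalWord f f a
      exact Submodule.subset_span ⟨b, hb.symm⟩
    | zero => rw [star_zero]; exact Submodule.zero_mem _
    | add y z _ _ hy hz => rw [star_add]; exact Submodule.add_mem _ hy hz
    | smul c y _ hy => rw [star_smul]; exact Submodule.smul_mem _ _ hy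

/-- A `*`-homomorphism is determined by its values on generators. -/
lemma starHom_ext_of_generates {s : Set C}
    (hs : (NonUnitalStarAlgebra.adjoin ℂ s).topologicalClosure = ⊤) {Φ Ψ : C →⋆ₙₐ[ℂ] D}
    (h : ∀ x ∈ s, Φ x = Ψ x) : Φ = Ψ := by
  have hc : ∀ Φ : C →⋆ₙₐ[ℂ] D, Continuous Φ := fun Φ => by
    open scoped CStarAlgebra in exact map_continuous Φ
  ext x
  have hx : x ∈ (NonUnitalStarAlgebra.adjoin ℂ s).topologicalClosure := by
    rw [hs]
    trivial
  refine closure_minimal (t := {x | Φ x = Ψ x}) ?_ (isClosed_eq (hc Φ) (hc Ψ)) hx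
  intro y hy
  change Φ y = Ψ y
  induction hy using NonUnitalStarAlgebra.adjoin_induction with
  | mem y hy => exact h y hy
  | add y z _ _ hy hz => rw [map_add, map_add, hy, hz]
  | zero => rw [map_zero, map_zero]
  | mul y z _ _ hy hz => rw [map_mul, map_mul, hy, hz]
  | smul c y _ hy => rw [map_smul, map_smul, hy]
  | star y _ hy => rw [map_star, map_star, hy]

/-- Evaluation at a coordinate of a bounded product of `C*`-algebras. -/
def lpEval {ι : Type*} (𝒳 : ι → Type*) [∀ i, NonUnitalCStarAlgebra (𝒳 i)] (i : ι) :
    lp 𝒳 ⊤ →⋆ₙₐ[ℂ] 𝒳 i where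
  toFun x := x i
  map_smul' _ _ := rfl
  map_zero' := rfl
  map_add' _ _ := rfl
  map_mul' _ _ := rfl
  map_star' _ := rfl

/-- Relations that bound the generators and that can be checked on a jointly faithful family of
`*`-homomorphisms have a universal `C*`-algebra. -/
theorem exists_universal {G : Type u}
    (R : ∀ (𝒳 : Type (max u w)) [NonUnitalCStarAlgebra 𝒳], (G → 𝒳) → Prop)
    (hbdd : ∀ (𝒳 : Type (max u w)) [NonUnitalCStarAlgebra 𝒳] (f : G → 𝒳), R 𝒳 f → ∀ g, ‖f g‖ ≤ 1)
    (hfaithful : ∀ (𝒰 : Type (max u w)) [NonUnitalCStarAlgebra 𝒰] (f : G → 𝒰) (ι : Type u)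
      (𝒳 : ι → Type (max u w)) [∀ i, NonUnitalCStarAlgebra (𝒳 i)] (Φ : ∀ i, 𝒰 →⋆ₙₐ[ℂ] 𝒳 i),
      (∀ x y, (∀ i, Φ i x = Φ i y) → x = y) → (∀ i, R (𝒳 i) fun g => Φ i (f g)) → R 𝒰 f) :
    ∃ (𝒰 : Type (max u w)) (_ : NonUnitalCStarAlgebra 𝒰) (f : G → 𝒰), R 𝒰 f ∧
      (NonUnitalStarAlgebra.adjoin ℂ (Set.range f)).topologicalClosure = ⊤ ∧
      ∀ (𝒳 : Type (max u w)) [NonUnitalCStarAlgebra 𝒳] (h : G → 𝒳), R 𝒳 h →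
        ∃ Φ : 𝒰 →⋆ₙₐ[ℂ] 𝒳, ∀ g, Φ (f g) = h g := by
  -- All representations together do not form a small index set. It suffices to pick, for each
  -- `*`-polynomial and each rational number exceeded by its norm in some representation, one such
  -- representation; these pairs form a type in the universe of `G`.
  let ι : Type u := {q : (FreeSemigroup (G × Bool) →₀ ℂ) × ℚ //
    ∃ (𝒳 : Type (max u w)) (_ : NonUnitalCStarAlgebra 𝒳) (h : G → 𝒳), R 𝒳 h ∧
      (q.2 : ℝ) < ‖Finsupp.linearCombination ℂ (evalWord h) q.1‖}
  choose 𝒳 inst h hR hlt using fun i : ι => i.2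
  -- The uniform bound `1` on generators places the family in the bounded product.
  let F : G → lp 𝒳 ⊤ := fun g =>
    ⟨fun i => h i g, memℓp_infty ⟨1, by rintro _ ⟨i, rfl⟩; exact hbdd _ _ (hR i) g⟩⟩
  let T : NonUnitalStarSubalgebra ℂ (lp 𝒳 ⊤) :=
    (NonUnitalStarAlgebra.adjoin ℂ (Set.range F)).topologicalClosure
  let instT : NonUnitalCStarAlgebra T := NonUnitalStarSubalgebra.nonUnitalCStarAlgebra T
    (h_closed := NonUnitalStarSubalgebra.isClosed_topologicalClosure _)
  have hF : ∀ g, F g ∈ T := fun g => NonUnitalStarSubalgebra.le_topologicalClosure _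
    (NonUnitalStarAlgebra.subset_adjoin ℂ _ ⟨g, rfl⟩)
  let f : G → T := fun g => ⟨F g, hF g⟩
  let Φ : ∀ i, T →⋆ₙₐ[ℂ] 𝒳 i := fun i =>
    (lpEval 𝒳 i).comp (NonUnitalStarSubalgebraClass.subtype T)
  have hgen : (NonUnitalStarAlgebra.adjoin ℂ (Set.range f)).topologicalClosure = ⊤ := by
    refine SetLike.ext fun x => iff_of_true ?_ trivial
    refine closure_subtype.2 (closure_mono ?_ x.2)
    intro y hy
    induction hy using NonUnitalStarAlgebra.adjoin_induction with
    | mem y hy =>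
      obtain ⟨g, rfl⟩ := hy
      exact ⟨f g, NonUnitalStarAlgebra.subset_adjoin ℂ _ ⟨g, rfl⟩, rfl⟩
    | add y z _ _ hy hz =>
      obtain ⟨y, hy, rfl⟩ := hy
      obtain ⟨z, hz, rfl⟩ := hz
      exact ⟨y + z, add_mem hy hz, rfl⟩
    | zero => exact ⟨0, zero_mem _, rfl⟩
    | mul y z _ _ hy hz =>
      obtain ⟨y, hy, rfl⟩ := hy
      obtain ⟨z, hz, rfl⟩ := hz
      exact ⟨y * z, mul_mem hy hz, rfl⟩
    | smul c y _ hy =>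
      obtain ⟨y, hy, rfl⟩ := hy
      exact ⟨c • y, SMulMemClass.smul_mem c hy, rfl⟩
    | star y _ hy =>
      obtain ⟨y, hy, rfl⟩ := hy
      exact ⟨star y, star_mem hy, rfl⟩
  refine ⟨T, instT, f, ?_, hgen, ?_⟩
  · exact hfaithful T f ι 𝒳 Φ (fun x y hxy => Subtype.ext (lp.ext (funext hxy))) hR
  · intro 𝒴 _ k hk
    obtain ⟨Ψ, hΨ, -⟩ := exists_starHom_of_norm_le (a := evalWord f) (b := evalWord k)
      (mem_closure_span_evalWord hgen)
      (fun c => by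
        by_contra! hc
        -- If a polynomial had larger norm at `k` than at `f`, a rational `q` strictly between would
        -- index a coordinate in which its norm exceeds `q`, although coordinate evaluation is
        -- contractive.
        obtain ⟨q, hq, hq'⟩ := exists_rat_btwn hc
        let i : ι := ⟨(c, q), 𝒴, inferInstance, k, hk, hq'⟩
        have h1 : Φ i (Finsupp.linearCombination ℂ (evalWord f) c) =
            Finsupp.linearCombination ℂ (evalWord (h i)) c := by
          refine (Finsupp.apply_linearCombination ℂ (Φ i : T →ₗ[ℂ] 𝒳 i) (evalWord f) c).trans ?_
          congr 2
          ext x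
          exact map_evalWord (Φ i) f x
        have h2 := NonUnitalStarAlgHom.norm_apply_le (Φ i)
          (Finsupp.linearCombination ℂ (evalWord f) c)
        rw [h1] at h2
        exact lt_irrefl _ ((hlt i).trans_le (h2.trans hq.le)))
      (fun x y => ⟨x * y, (map_mul _ _ _).symm, (map_mul _ _ _).symm⟩)
      (fun x => exists_star_evalWord f k x)
    refine ⟨Ψ, fun g => ?_⟩
    simpa [evalWord_of] using hΨ (FreeSemigroup.of (g, false))

end Universal

/-! ### The universal representations -/

section UniversalRepresentation

/-- The composition of a representation with a `*`-homomorphism. -/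
def ToeplitzRep.map {C : Type u} {E : Type v} [NonUnitalCommCStarAlgebra C]
    [PartialOrder C] [StarOrderedRing C] [NormedAddCommGroup E] [NormedSpace ℂ E] [SMul C E]
    [CStarModule C E] {φ : C →⋆ₙₐ[ℂ] Adjointable C E} {𝒳 𝒴 : Type*} [NonUnitalCStarAlgebra 𝒳]
    [NonUnitalCStarAlgebra 𝒴] (ρ : ToeplitzRep φ 𝒳) (Φ : 𝒳 →⋆ₙₐ[ℂ] 𝒴) : ToeplitzRep φ 𝒴 where
  π := Φ.comp ρ.π
  t := (Φ : 𝒳 →ₗ[ℂ] 𝒴) ∘ₗ ρ.t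
  star_t_mul_t x y := by
    change star (Φ (ρ.t x)) * Φ (ρ.t y) = Φ (ρ.π _)
    rw [← map_star, ← map_mul, ρ.star_t_mul_t]
  π_mul_t f x := by
    change Φ (ρ.π f) * Φ (ρ.t x) = Φ (ρ.t _)
    rw [← map_mul, ρ.π_mul_t]

variable {B : Type u} {L : Type v} [GeneralizedBooleanAlgebra B]

namespace RelativeBooleanDynamicalSystem

variable (S : RelativeBooleanDynamicalSystem B L)

variable {S} in
-- By (iii), `s* s` is a projection; this is the bound that the universal construction needs.
lemma IsRepresentation.norm_s_le {𝒳 : Type w} [NonUnitalCStarAlgebra 𝒳] {P : B → 𝒳}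
    {s : ∀ α : L, S.I α → 𝒳} (h : S.IsRepresentation P s) (α : L) (C : S.I α) : ‖s α C‖ ≤ 1 := by
  have h1 := CStarRing.norm_star_mul_self (x := s α C)
  rw [h.star_s_mul_s] at h1
  have h2 := (h.isStarProjection ((C : B) ⊓ C)).norm_le
  nlinarith [norm_nonneg (s α C)]

variable {S} in
-- All relations are equations between `*`-polynomials in the generators, so they can be tested on a
-- jointly injective family of `*`-homomorphisms.
lemma IsRepresentation.of_faithful {𝒰 : Type w} [NonUnitalCStarAlgebra 𝒰] {P : B → 𝒰}
    {s : ∀ α : L, S.I α → 𝒰} {ι : Type*} {𝒳 : ι → Type*} [∀ i, NonUnitalCStarAlgebra (𝒳 i)]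
    {Φ : ∀ i, 𝒰 →⋆ₙₐ[ℂ] 𝒳 i} (hΦ : ∀ x y, (∀ i, Φ i x = Φ i y) → x = y)
    (h : ∀ i, S.IsRepresentation (fun A => Φ i (P A)) fun α C => Φ i (s α C)) :
    S.IsRepresentation P s where
  isStarProjection A :=
    { isIdempotentElem := hΦ _ _ fun i => by
        rw [map_mul]
        exact ((h i).isStarProjection A).isIdempotentElem
      isSelfAdjoint := hΦ _ _ fun i => by
        rw [map_star]
        exact ((h i).isStarProjection A).isSelfAdjoint }
  isPartialIsometry α C := hΦ _ _ fun i => by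
    rw [map_mul, map_mul, map_star]
    exact (h i).isPartialIsometry α C
  map_bot := hΦ _ _ fun i => by
    rw [map_zero]
    exact (h i).map_bot
  map_inf A A' := hΦ _ _ fun i => by
    rw [map_mul]
    exact (h i).map_inf A A'
  map_sup A A' := hΦ _ _ fun i => by
    rw [map_sub, map_add]
    exact (h i).map_sup A A'
  P_mul_s A α C := hΦ _ _ fun i => by
    rw [map_mul, map_mul]
    exact (h i).P_mul_s A α C
  star_s_mul_s α C C' := hΦ _ _ fun i => by
    rw [map_mul, map_star]
    exact (h i).star_s_mul_s α C C'
  star_s_mul_s_of_ne α α' C C' hα := hΦ _ _ fun i => by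
    rw [map_mul, map_star, map_zero]
    exact (h i).star_s_mul_s_of_ne α α' C C' hα
  P_eq_sum A hA := hΦ _ _ fun i => by
    -- Finiteness of `Δ_A` for `A ∈ J` is what lets `Φ i` pass through the sum in (iv).
    rw [finsum_mem_eq_finite_toFinset_sum _ (S.finite_Δ hA), map_sum]
    refine ((h i).P_eq_sum A hA).trans ?_
    rw [finsum_mem_eq_finite_toFinset_sum _ (S.finite_Δ hA)]
    exact Finset.sum_congr rfl fun α _ => by rw [map_mul, map_star]

theorem exists_isUniversalRepresentation :
    ∃ (𝒰 : Type (max u v w)) (_ : NonUnitalCStarAlgebra 𝒰) (p : B → 𝒰) (s : ∀ α : L, S.I α → 𝒰),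
      S.IsUniversalRepresentation p s := by
  obtain ⟨𝒰, _, f, hf, hgen, huniv⟩ := exists_universal.{max u v, w}
    (G := B ⊕ Σ α, S.I α)
    (fun 𝒳 _ f => S.IsRepresentation (fun A => f (Sum.inl A)) fun α C => f (Sum.inr ⟨α, C⟩))
    (fun 𝒳 _ f h g => by
      rcases g with A | ⟨α, C⟩
      · exact (h.isStarProjection A).norm_le
      · exact h.norm_s_le α C)
    (fun 𝒰 _ f ι 𝒳 _ Φ hΦ h => IsRepresentation.of_faithful hΦ h)
  have hrange : Set.range f = Set.range (fun A => f (Sum.inl A)) ∪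
      {x | ∃ α C, x = f (Sum.inr ⟨α, C⟩)} := by
    ext x
    constructor
    · rintro ⟨A | ⟨α, C⟩, rfl⟩
      · exact Or.inl ⟨A, rfl⟩
      · exact Or.inr ⟨α, C, rfl⟩
    · rintro (⟨A, rfl⟩ | ⟨α, C, rfl⟩)
      · exact ⟨_, rfl⟩
      · exact ⟨_, rfl⟩
  refine ⟨𝒰, inferInstance, fun A => f (Sum.inl A), fun α C => f (Sum.inr ⟨α, C⟩), hf,
    hrange ▸ hgen, fun 𝒳 _ P T h => ?_⟩
  obtain ⟨Φ, hΦ⟩ := huniv 𝒳 (Sum.elim P fun q => T q.1 q.2) h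
  refine ⟨Φ, ⟨fun A => hΦ _, fun α C => hΦ _⟩, fun Ψ hΨ => starHom_ext_of_generates hgen ?_⟩
  rintro _ ⟨A | ⟨α, C⟩, rfl⟩
  · exact (hΨ.1 A).trans (hΦ (Sum.inl A)).symm
  · exact (hΨ.2 α C).trans (hΦ (Sum.inr ⟨α, C⟩)).symm

variable {S}

/-- A coisometric representation of `X` induces a representation of the dynamical system, which
factors through `𝒰`; the factorization agrees with `σ` on the `χ_A` and the `e_{α,C}`, hence
everywhere. -/
lemma IsUniversalRepresentation.isRelativeCuntzPimsner {𝒰 : Type w} [NonUnitalCStarAlgebra 𝒰]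
    {ρ : ToeplitzRep S.φ 𝒰}
    (h : S.IsUniversalRepresentation (fun A => ρ.π (chi A)) fun α C => ρ.t (S.e α C)) :
    ρ.IsRelativeCuntzPimsner S.K where
  isCoisometric := IsRepresentation.isCoisometric h.isRepresentation
  generates := by
    refine top_le_iff.1 (h.generates.symm.le.trans
      (NonUnitalStarSubalgebra.topologicalClosure_mono (NonUnitalStarAlgebra.adjoin_mono ?_)))
    rintro _ (⟨A, rfl⟩ | ⟨α, C, rfl⟩)
    · exact Or.inl ⟨_, rfl⟩
    · exact Or.inr ⟨_, rfl⟩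
  universal 𝒳 _ σ hσ := by
    obtain ⟨Φ, hΦ, huniq⟩ := h.universal 𝒳 _ _ (S.isRepresentation_of_isCoisometric hσ)
    have hmap : ρ.map Φ = σ := ToeplitzRep.ext_generators hΦ.1 hΦ.2
    refine ⟨Φ, ⟨fun f => congrArg (fun τ : ToeplitzRep S.φ 𝒳 => τ.π f) hmap,
      fun x => congrArg (fun τ : ToeplitzRep S.φ 𝒳 => τ.t x) hmap⟩, fun Ψ hΨ => ?_⟩
    exact huniq Ψ ⟨fun A => hΨ.1 _, fun α C => hΨ.2 _⟩

/-- The two universal algebras are canonically isomorphic. -/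
theorem IsUniversalRepresentation.exists_starAlgEquiv {𝒰 𝒪 : Type w} [NonUnitalCStarAlgebra 𝒰]
    [NonUnitalCStarAlgebra 𝒪] {p : B → 𝒰} {s : ∀ α : L, S.I α → 𝒰} {ρ : ToeplitzRep S.φ 𝒪}
    (hp : S.IsUniversalRepresentation p s) (hρ : ρ.IsRelativeCuntzPimsner S.K) :
    ∃ Φ : 𝒰 ≃⋆ₐ[ℂ] 𝒪, (∀ A, Φ (p A) = ρ.π (chi A)) ∧ ∀ α C, Φ (s α C) = ρ.t (S.e α C) := by
  -- Replacing `(p, s)` by the corresponding representation `σ` of `X` on `𝒰` makes `𝒰` and `𝒪`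
  -- carry the same universal property; the two factorizations are then mutually inverse.
  obtain ⟨σ, hσπ, hσt⟩ := IsRepresentation.exists_toeplitzRep hp.isRepresentation
  obtain rfl : (fun A => σ.π (chi A)) = p := funext hσπ
  obtain rfl : (fun α C => σ.t (S.e α C)) = s := funext fun α => funext (hσt α)
  have hσ := hp.isRelativeCuntzPimsner
  obtain ⟨Φ, hΦ, -⟩ := hσ.universal 𝒪 ρ hρ.isCoisometric
  obtain ⟨Ψ, hΨ, -⟩ := hρ.universal 𝒰 σ hσ.isCoisometric
  have h1 : Ψ.comp Φ = NonUnitalStarAlgHom.id ℂ 𝒰 := by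
    refine starHom_ext_of_generates hσ.generates ?_
    rintro _ (⟨f, rfl⟩ | ⟨x, rfl⟩)
    · exact (congrArg Ψ (hΦ.1 f)).trans (hΨ.1 f)
    · exact (congrArg Ψ (hΦ.2 x)).trans (hΨ.2 x)
  have h2 : Φ.comp Ψ = NonUnitalStarAlgHom.id ℂ 𝒪 := by
    refine starHom_ext_of_generates hρ.generates ?_
    rintro _ (⟨f, rfl⟩ | ⟨x, rfl⟩)
    · exact (congrArg Φ (hΨ.1 f)).trans (hΦ.1 f)
    · exact (congrArg Φ (hΨ.2 x)).trans (hΦ.2 x)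
  exact ⟨{ Φ with
    toFun := Φ
    invFun := Ψ
    left_inv := fun x => congrArg (fun Θ : 𝒰 →⋆ₙₐ[ℂ] 𝒰 => Θ x) h1
    right_inv := fun x => congrArg (fun Θ : 𝒪 →⋆ₙₐ[ℂ] 𝒪 => Θ x) h2 },
    fun A => hΦ.1 _, fun α C => hΦ.2 _⟩

end RelativeBooleanDynamicalSystem

end UniversalRepresentation

end RelBoolSys

end

theorem mainTheorem5 {B : Type u} {L : Type v} [GeneralizedBooleanAlgebra B]
    (S : RelativeBooleanDynamicalSystem B L) :
    -- the bijective correspondence, for representations in any `C*`-algebra `𝒳`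
    (∀ (𝒳 : Type w) [NonUnitalCStarAlgebra 𝒳],
      Set.BijOn
        (fun ρ : ToeplitzRep S.φ 𝒳 =>
          ((fun A => ρ.π (chi A), fun α C => ρ.t (S.e α C)) : (B → 𝒳) × (∀ α : L, S.I α → 𝒳)))
        {ρ | ρ.IsCoisometric S.K}
        {F | S.IsRepresentation F.1 F.2}) ∧
    -- `C*(B, L, θ, I_α; J)` and `𝒪_(K_J, X)` exist
    (∃ (𝒰 : Type (max u v w)) (_ : NonUnitalCStarAlgebra 𝒰) (p : B → 𝒰) (s : ∀ α : L, S.I α → 𝒰),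
      S.IsUniversalRepresentation p s) ∧
    (∃ (𝒪 : Type (max u v w)) (_ : NonUnitalCStarAlgebra 𝒪) (ρ : ToeplitzRep S.φ 𝒪),
      ρ.IsRelativeCuntzPimsner S.K) ∧
    -- `C*(B, L, θ, I_α; J)` and `𝒪_(K_J, X)` are canonically isomorphic
    (∀ (𝒰 𝒪 : Type (max u v w)) [NonUnitalCStarAlgebra 𝒰] [NonUnitalCStarAlgebra 𝒪]
      (p : B → 𝒰) (s : ∀ α : L, S.I α → 𝒰) (ρ : ToeplitzRep S.φ 𝒪),
      S.IsUniversalRepresentation p s → ρ.IsRelativeCuntzPimsner S.K →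
        ∃ Φ : 𝒰 ≃⋆ₐ[ℂ] 𝒪, (∀ A, Φ (p A) = ρ.π (chi A)) ∧ ∀ α C, Φ (s α C) = ρ.t (S.e α C)) := by
  refine ⟨fun 𝒳 _ => RelativeBooleanDynamicalSystem.bijOn_isCoisometric S,
    RelativeBooleanDynamicalSystem.exists_isUniversalRepresentation.{u, v, w} S, ?_,
    fun 𝒰 𝒪 _ _ p s ρ hp hρ => hp.exists_starAlgEquiv hρ⟩
  -- The relative Cuntz–Pimsner algebra is realized on the same algebra `𝒰`, with the representation
  -- of `X` that corresponds to `(p, s)`.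
  obtain ⟨𝒰, inst, p, s, h⟩ :=
    RelativeBooleanDynamicalSystem.exists_isUniversalRepresentation.{u, v, w} S
  obtain ⟨ρ, hπ, ht⟩ :=
    RelativeBooleanDynamicalSystem.IsRepresentation.exists_toeplitzRep h.isRepresentation
  obtain rfl : (fun A => ρ.π (chi A)) = p := funext hπ
  obtain rfl : (fun α C => ρ.t (S.e α C)) = s := funext fun α => funext (ht α)
  exact ⟨𝒰, inst, ρ, h.isRelativeCuntzPimsner⟩
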